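/- Let $n_1,n_2,\varkappa\ge 1$ be integers, write $x=(x',x'')\in\mathbb R^{n_1}\times\mathbb R^{n_2}=\mathbb R^{n_1+n_2}$, and let $G_\varkappa=-\Delta_{x'}-V_\varkappa(x')\Delta_{x''}$ be the Grushin operator, where $V_\varkappa(x')$ is either $|x'|^{2\varkappa}$ or $\sum_{i=1}^{n_1}(x_i')^{2\varkappa}$, regarded as a non-negative self-adjoint operator on $L^2(\mathbb R^{n_1+n_2})$ (given by the closure of its quadratic form on $C_c^\infty$). Put $Q=n_1+(1+\varkappa)n_2$ and $$d(x,y)=|x'-y'|+\begin{cases}\dfrac{|x''-y''|}{(|x'|+|y'|)^{\varkappa}} & \text{if } |x''-y''|^{1/(1+\varkappa)}\le |x'|+|y'|,\ (x',y')\neq(0,0),\\[2mm] |x''-y''|^{1/(1+\varkappa)} & \text{otherwise,}\end{cases}$$ let $B(x,r)=\{y: d(x,y)<r\}$ and let $|B(x,r)|$ be its Lebesgue measure. Let $X$ be the vector of all the fields $\partial_{x_i'}$ $(1\le i\le n_1)$ and $(x')^\alpha\partial_{x_k''}$ $(1\le k\le n_2,\ \alpha\in\mathbb N^{n_1},\ |\alpha|=\varkappa)$,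 and let $X_y$ denote $X$ acting in the variable $y$. Let $T$ be a bounded linear operator on $L^2(\mathbb R^{n_1+n_2})$ and let $T_j=T\circ\chi_j(G_\varkappa)$ for $j\in\mathbb N=\{0,1,2,\dots\}$, where $\chi_0(G_\varkappa)=\mathbf 1_{[0,1)}(G_\varkappa)$ and $\chi_j(G_\varkappa)=\mathbf 1_{[2^{j-1},2^j)}(G_\varkappa)$ for $j\ge1$ are spectral projections. Suppose that the operators $T_j$ have integral kernels $T_j(x,y)$, differentiable in $y$ for every $x$, and that for some $R_0\ge Q+\frac12$ there is a constant $C$ such that for all $\mathfrak r\in[0,R_0]$, all $j\in\mathbb N$ and all $x,y\in\mathbb R^{n_1+n_2}$, $$|B(x,2^{-j/2})|^{1/2}\,|B(y,2^{-j/2})|^{1/2}\,d(x,y)^{\mathfrak r}\,|T_j(x,y)|\le C\,2^{-j\mathfrak r/2},$$ $$|B(x,2^{-j/2})|^{1/2}\,|B(y,2^{-j/2})|^{1/2}\,d(x,y)^{\mathfrak r}\,|X_yT_j(x,y)|\le C\,2^{-j\mathfrak r/2}\,2^{j/2}.$$ Then $T$ is of weak type $(1,1)$: there is a constant $C'$ such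 that $|\{x:|Tf(x)|>\varepsilon\}|\le \dfrac{C'}{\varepsilon}\|f\|_{L^1}$ for all $f\in L^1\cap L^2(\mathbb R^{n_1+n_2})$ and all $\varepsilon>0$. -/

import Mathlib

open MeasureTheory

open scoped ContDiff

noncomputable section

namespace Grushin

/-- `ℝ^{n₁+n₂} = ℝ^{n₁} × ℝ^{n₂}`, points `x = (x', x'')`, with Lebesgue measure `volume`.
Each factor carries its Euclidean norm. -/
abbrev Space (n₁ n₂ : ℕ) : Type :=
  EuclideanSpace ℝ (Fin n₁) × EuclideanSpace ℝ (Fin n₂)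

/-- The complex Hilbert space `L²(ℝ^{n₁+n₂})`. -/
abbrev L2 (n₁ n₂ : ℕ) : Type :=
  Lp ℂ 2 (volume : Measure (Space n₁ n₂))

/-- The homogeneous dimension `Q = n₁ + (1 + ϰ) n₂`. -/
def homDim (n₁ n₂ ϰ : ℕ) : ℝ := n₁ + (1 + ϰ) * n₂

variable {n₁ n₂ : ℕ}

/-! ### The Grushin distance and its balls -/

/-- The Grushin (quasi-)distance `d`. -/
def grushinDist (ϰ : ℕ) (x y : Space n₁ n₂) : ℝ :=
  ‖x.1 - y.1‖ +
    if ‖x.2 - y.2‖ ^ ((1 : ℝ) / (1 + ϰ)) ≤ ‖x.1‖ + ‖y.1‖ then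
      ‖x.2 - y.2‖ / (‖x.1‖ + ‖y.1‖) ^ ϰ
    else ‖x.2 - y.2‖ ^ ((1 : ℝ) / (1 + ϰ))

/-- `B(x, r) = {y : d(x, y) < r}`. -/
def grushinBall (ϰ : ℕ) (x : Space n₁ n₂) (r : ℝ) : Set (Space n₁ n₂) :=
  {y | grushinDist ϰ x y < r}

/-- `|B(x, r)|`, the Lebesgue measure of the ball. -/
def ballVol (ϰ : ℕ) (x : Space n₁ n₂) (r : ℝ) : ℝ :=
  volume.real (grushinBall ϰ x r)

/-! ### The vector fields -/

/-- `∂f/∂x'_i`. -/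
def partialFst (i : Fin n₁) (f : Space n₁ n₂ → ℂ) (x : Space n₁ n₂) : ℂ :=
  fderiv ℝ f x (EuclideanSpace.single i 1, 0)

/-- `∂f/∂x''_k`. -/
def partialSnd (k : Fin n₂) (f : Space n₁ n₂ → ℂ) (x : Space n₁ n₂) : ℂ :=
  fderiv ℝ f x (0, EuclideanSpace.single k 1)

/-- `X_{α,k} f = x'^α ∂f/∂x''_k`. -/
def fieldSnd (α : Fin n₁ → ℕ) (k : Fin n₂) (f : Space n₁ n₂ → ℂ) (x : Space n₁ n₂) : ℂ :=
  ((∏ i, x.1 i ^ α i : ℝ) : ℂ) * partialSnd k f x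

/-- `|X f(x)|`, the Euclidean length of the vector of all `X_i f(x)`, `1 ≤ i ≤ n₁`, and all
`X_{α,k} f(x)`, `|α| = ϰ`, `1 ≤ k ≤ n₂`. -/
def gradNorm (ϰ : ℕ) (f : Space n₁ n₂ → ℂ) (x : Space n₁ n₂) : ℝ :=
  Real.sqrt (∑ i, ‖partialFst i f x‖ ^ 2 +
    ∑ α ∈ Finset.piAntidiag (Finset.univ : Finset (Fin n₁)) ϰ, ∑ k, ‖fieldSnd α k f x‖ ^ 2)

/-! ### Spectral projections of bounded self-adjoint operators -/

section

variable {H : Type*} [NormedAddCommGroup H] [InnerProductSpace ℂ H] [CompleteSpace H]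

/-- The closure of the range of `(A - a)⁺`, where `A` is a bounded self-adjoint operator and the
positive part is taken in the continuous functional calculus. -/
def subspaceAbove (A : H →L[ℂ] H) (a : ℝ) : Submodule ℂ H :=
  (LinearMap.range
    (cfc (fun t : ℝ => max (t - a) 0) A : H →L[ℂ] H).toLinearMap).topologicalClosure

instance (A : H →L[ℂ] H) (a : ℝ) : CompleteSpace (subspaceAbove A a) :=
  inferInstanceAs (CompleteSpace (Submodule.topologicalClosure _))

/-- The spectral projection `1_{(a,∞)}(A)` of a bounded self-adjoint operator `A`: the orthogonal
projection onto the closure of the range of `(A - a)⁺`. -/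
def projAbove (A : H →L[ℂ] H) (a : ℝ) : H →L[ℂ] H :=
  (subspaceAbove A a).starProjection

end

/-! ### The Grushin operator and its spectral projections -/

/-- The two admissible choices of the potential `V_ϰ`. -/
inductive Potential : Type
  /-- `V_ϰ(x') = |x'|^{2ϰ}` -/
  | radial : Potential
  /-- `V_ϰ(x') = ∑ i, x'_i^{2ϰ}` -/
  | separable : Potential

/-- The value `V_ϰ(x')`. -/
def Potential.eval (ϰ : ℕ) : Potential → EuclideanSpace ℝ (Fin n₁) → ℝ
  | .radial, x' => ‖x'‖ ^ (2 * ϰ)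
  | .separable, x' => ∑ i, x' i ^ (2 * ϰ)

/-- The Hilbert space `L² ⊕ (L²)^{n₁} ⊕ (L²)^{n₂}`. -/
abbrev Triples (n₁ n₂ : ℕ) : Type :=
  PiLp 2 (fun _ : Option (Fin n₁ ⊕ Fin n₂) => L2 n₁ n₂)

/-- All `(φ, (∂φ/∂x'_i)_i, (V_ϰ^{1/2} ∂φ/∂x''_k)_k)` with `φ ∈ C_c^∞(ℝ^{n₁+n₂})`. The square of the
norm of this element is `‖φ‖² + ⟨G_ϰ φ, φ⟩`, where `G_ϰ = -Δ_{x'} - V_ϰ(x') Δ_{x''}`. -/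
def testTriples (ϰ : ℕ) (V : Potential) : Set (Triples n₁ n₂) :=
  {w | ∃ φ : Space n₁ n₂ → ℂ, ContDiff ℝ ∞ φ ∧ HasCompactSupport φ ∧
    w none =ᵐ[volume] φ ∧
    (∀ i, w (some (Sum.inl i)) =ᵐ[volume] partialFst i φ) ∧
    (∀ k, w (some (Sum.inr k)) =ᵐ[volume]
      fun x => (Real.sqrt (V.eval ϰ x.1) : ℂ) * partialSnd k φ x)}

/-- The domain of the closed quadratic form of `G_ϰ` with its form norm: the closure of
`C_c^∞(ℝ^{n₁+n₂})`, each function being listed along with its derivatives. -/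
def formDomain (n₁ n₂ ϰ : ℕ) (V : Potential) : Submodule ℂ (Triples n₁ n₂) :=
  (Submodule.span ℂ (testTriples ϰ V)).topologicalClosure

instance (n₁ n₂ ϰ : ℕ) (V : Potential) : CompleteSpace (formDomain n₁ n₂ ϰ V) :=
  inferInstanceAs (CompleteSpace (Submodule.span ℂ (testTriples ϰ V)).topologicalClosure)

/-- The embedding `J` of the form domain into `L²`. -/
def formEmbedding (n₁ n₂ ϰ : ℕ) (V : Potential) : formDomain n₁ n₂ ϰ V →L[ℂ] L2 n₁ n₂ :=
  (PiLp.proj 2 (fun _ : Option (Fin n₁ ⊕ Fin n₂) => L2 n₁ n₂) none :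
    Triples n₁ n₂ →L[ℂ] L2 n₁ n₂).comp (formDomain n₁ n₂ ϰ V).subtypeL

/-- The resolvent `(1 + G_ϰ)⁻¹` of the self-adjoint operator `G_ϰ` on `L²(ℝ^{n₁+n₂})` given by its
closed form. It is `J J*`: the vector `w = J* f` is the one with `⟪w, v⟫ = ⟪f, J v⟫` for all `v` in
the form domain, that is, `u = J w` is the weak solution of `u + G_ϰ u = f`. -/
def grushinResolvent (n₁ n₂ ϰ : ℕ) (V : Potential) : L2 n₁ n₂ →L[ℂ] L2 n₁ n₂ :=
  (formEmbedding n₁ n₂ ϰ V).comp (ContinuousLinearMap.adjoint (formEmbedding n₁ n₂ ϰ V))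

/-- The spectral projection `1_{[0,R)}(G_ϰ)`. In terms of the resolvent `A = (1 + G_ϰ)⁻¹` it is
`1_{(a,∞)}(A)` with `a = (1 + R)⁻¹`. -/
def spectralProj (n₁ n₂ ϰ : ℕ) (V : Potential) (R : ℝ) : L2 n₁ n₂ →L[ℂ] L2 n₁ n₂ :=
  projAbove (grushinResolvent n₁ n₂ ϰ V) (1 + R)⁻¹

/-- The spectral projections `χ_0(G_ϰ) = 1_{[0,1)}(G_ϰ)` and
`χ_j(G_ϰ) = 1_{[2^{j-1},2^j)}(G_ϰ)` for `j ≥ 1`. -/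
def chi (n₁ n₂ ϰ : ℕ) (V : Potential) : ℕ → (L2 n₁ n₂ →L[ℂ] L2 n₁ n₂)
  | 0 => spectralProj n₁ n₂ ϰ V 1
  | j + 1 => spectralProj n₁ n₂ ϰ V (2 ^ (j + 1)) - spectralProj n₁ n₂ ϰ V (2 ^ j)

/-! ### Integral kernels, the two kernel conditions, weak type -/

/-- `K` is an integral kernel of the bounded operator `S` on `L²`:
`S f (x) = ∫ K(x,y) f(y) dy` for almost every `x`, for all compactly supported `f ∈ L²`. -/
def IsIntegralKernel (S : L2 n₁ n₂ →L[ℂ] L2 n₁ n₂) (K : Space n₁ n₂ → Space n₁ n₂ → ℂ) : Prop :=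
  AEStronglyMeasurable (Function.uncurry K) (volume.prod volume) ∧
  ∀ (f : Space n₁ n₂ → ℂ) (hf : MemLp f 2 volume), HasCompactSupport f →
    ∀ᵐ x, Integrable (fun y => K x y * f y) volume ∧ S (hf.toLp f) x = ∫ y, K x y * f y

/-- The pointwise size condition on the kernels `K_j` up to the order `R₀`. The constant does not
depend on `j`, `r`, `x`, `y`. -/
def SupCondition (ϰ : ℕ) (R₀ : ℝ) (K : ℕ → Space n₁ n₂ → Space n₁ n₂ → ℂ) : Prop :=
  ∃ C : ℝ, ∀ r ∈ Set.Icc 0 R₀, ∀ (j : ℕ) (x y : Space n₁ n₂),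
    ballVol ϰ x (2 ^ (-(j : ℝ) / 2)) ^ ((1 : ℝ) / 2) *
      ballVol ϰ y (2 ^ (-(j : ℝ) / 2)) ^ ((1 : ℝ) / 2) * grushinDist ϰ x y ^ r * ‖K j x y‖
      ≤ C * 2 ^ (-(j : ℝ) * r / 2)

/-- The pointwise condition on the gradients `X_y K_j(x,y)` in the second variable up to the order
`R₀` (the functions `K_j(x,·)` being differentiable). -/
def GradSupCondition (ϰ : ℕ) (R₀ : ℝ) (K : ℕ → Space n₁ n₂ → Space n₁ n₂ → ℂ) : Prop :=
  (∀ (j : ℕ) (x : Space n₁ n₂), Differentiable ℝ (K j x)) ∧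
  ∃ C : ℝ, ∀ r ∈ Set.Icc 0 R₀, ∀ (j : ℕ) (x y : Space n₁ n₂),
    ballVol ϰ x (2 ^ (-(j : ℝ) / 2)) ^ ((1 : ℝ) / 2) *
      ballVol ϰ y (2 ^ (-(j : ℝ) / 2)) ^ ((1 : ℝ) / 2) * grushinDist ϰ x y ^ r * gradNorm ϰ (K j x) y
      ≤ C * (2 ^ (-(j : ℝ) * r / 2) * 2 ^ ((j : ℝ) / 2))

/-- `T` is of weak type `(1,1)`: `|{|T f| > ε}| ≤ (C / ε) ‖f‖₁` for all `f ∈ L¹ ∩ L²`, `ε > 0`. -/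
def IsWeakTypeOneOne (T : L2 n₁ n₂ →L[ℂ] L2 n₁ n₂) : Prop :=
  ∃ C : ℝ, ∀ f : L2 n₁ n₂, Integrable f volume → ∀ ε : ℝ, 0 < ε →
    volume {x | ε < ‖T f x‖} ≤ ENNReal.ofReal (C / ε * ∫ x, ‖f x‖)

end Grushin

end

noncomputable section

namespace Grushin

/-! ### Spectral projections of a bounded non-negative operator near the bottom of its spectrum. -/

section SpectralProjections

variable {H : Type*} [NormedAddCommGroup H] [InnerProductSpace ℂ H] [CompleteSpace H]

open Filter Topology

/-! The proof is a Calderón–Zygmund argument adapted to the Grushin geometry, applied to `T = ∑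
T_j`. The series converges strongly: the sums of the `χ_j` telescope to `1_{(a,∞)}(A)`, with `A` the
resolvent and `a → 0`, and `A` is non-negative with dense range (`tendsto_sum_chi`).

At scale `2^{-k}` the cubes have side `2^{-k}` in `x'` and side `2^{-k} ρ^ϰ` in `x''`, where `ρ` is
a dyadic size comparable to `max(2^{-k}, |x'|)`. Rounding `ρ` to a power of two makes these cubes
nested, with bounded volume ratio between consecutive scales. Hence a stopping-time decomposition `f
= g + b` is available, and `g` is handled by Chebyshev and the `L²` bound.

For `b`, fix a stopping cube of scale `2^{-k}` and compare it with the natural length `2^{-j/2}` of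
`T_j`. Decay of order `Q + 1/2` bounds the kernel at distance about `2^i 2^{-j/2}` by `2^{-i/2}`
over the volume of a box of that size, since shrinking a box by `2^i` costs at most a constant times
`2^{iQ}` in volume. Half of the surplus `2^{-i/2}` makes the dyadic majorant integrable
(`majorant`); the other half is available as a gain. If `2^{-k} ≥ 2^{-j/2}`, only large `i` occur
off the dilated cube and the size bound gains `2^{-(j-2k)/8}`. If `2^{-k} ≤ 2^{-j/2}`, the mean zero
of `b` and the gradient bound gain a power of `2^{-k}/2^{-j/2}`. Both are at most `2^{-|j-2k|/8}` up
to a constant (`exists_lintegral_compl_star_le`), which sums over `j` uniformly in `k`.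

The fields degenerate at `x' = 0`, so increments are taken through the centre of the projected cube:
its coordinates are half-integer multiples of the side, and one of them is at least `ρ/2`. There a
single monomial `x_i'^ϰ` controls the `x''` derivative.

Everything is done for continuous `f` of compact support. Continuity replaces the Lebesgue
differentiation theorem, and compact support makes the kernel formula applicable to `b`.
Simultaneous approximation in `L¹` and `L²` then gives the general case. -/

lemma norm_projAbove_apply_le (A : H →L[ℂ] H) (a : ℝ) (f : H) : ‖projAbove A a f‖ ≤ ‖f‖ :=
  (subspaceAbove A a).norm_starProjection_apply_le f

/-- The spectral projection `1_{(a,∞)}(A)` moves vectors in the range of `A ≥ 0` by at most `a`. -/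
lemma norm_sub_projAbove_le {A : H →L[ℂ] H} (hA : 0 ≤ A) {a : ℝ} (ha : 0 ≤ a) (h : H) :
    ‖A h - projAbove A a (A h)‖ ≤ a * ‖h‖ := by
  have hsa : IsSelfAdjoint A := .of_nonneg hA
  -- `t - (t - a)⁺ = min(t, a)`, which lies in `[0, a]` on the spectrum.
  have hsplit : A - cfc (fun t : ℝ => max (t - a) 0) A = cfc (fun t : ℝ => min t a) A := by
    nth_rewrite 1 [← cfc_id' ℝ A]
    rw [← cfc_sub (fun t : ℝ => t) (fun t : ℝ => max (t - a) 0) A]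
    congr 1
    funext t
    rcases le_total t a with h | h
    · rw [max_eq_right (by linarith), min_eq_left h, sub_zero]
    · rw [max_eq_left (by linarith), min_eq_right h]; ring
  have hnorm : ‖cfc (fun t : ℝ => min t a) A‖ ≤ a := by
    refine norm_cfc_le ha fun t ht => ?_
    have ht0 : 0 ≤ t := spectrum_nonneg_of_nonneg hA ht
    rw [Real.norm_eq_abs, abs_of_nonneg (le_min ht0 ha)]
    exact min_le_right _ _
  set B : H →L[ℂ] H := cfc (fun t : ℝ => max (t - a) 0) A with hB
  have hmem : B h ∈ subspaceAbove A a :=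
    Submodule.le_topologicalClosure _ ⟨h, rfl⟩
  -- The projection gives the nearest point of the subspace, and `B h` is a competitor in it.
  have hmin : ‖A h - projAbove A a (A h)‖ ≤ ‖A h - B h‖ := by
    have := (subspaceAbove A a).starProjection_minimal (A h)
    rw [projAbove, this]
    exact ciInf_le ⟨0, by rintro _ ⟨x, rfl⟩; positivity⟩ (⟨B h, hmem⟩ : subspaceAbove A a)
  calc _ ≤ ‖(A - B) h‖ := hmin
    _ ≤ ‖A - B‖ * ‖h‖ := (A - B).le_opNorm h
    _ ≤ a * ‖h‖ := by rw [hsplit]; gcongr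

/-- If `A ≥ 0` has dense range, then `1_{(a,∞)}(A)` tends strongly to the identity as `a → 0⁺`. -/
lemma tendsto_projAbove {A : H →L[ℂ] H} (hA : 0 ≤ A) (hd : DenseRange A) {a : ℕ → ℝ}
    (ha : ∀ n, 0 ≤ a n) (hlim : Tendsto a atTop (𝓝 0)) (f : H) :
    Tendsto (fun n => projAbove A (a n) f) atTop (𝓝 f) := by
  rw [Metric.tendsto_atTop]
  intro ε hε
  obtain ⟨h, hh⟩ := hd.exists_dist_lt f (show 0 < ε / 3 by positivity)
  have hlim' : Tendsto (fun n => a n * ‖h‖) atTop (𝓝 0) := by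
    simpa using hlim.mul_const ‖h‖
  obtain ⟨N, hN⟩ := (eventually_atTop).1 (hlim'.eventually (gt_mem_nhds (show 0 < ε / 3 by positivity)))
  refine ⟨N, fun n hn => ?_⟩
  rw [dist_eq_norm] at hh ⊢
  have h1 := norm_sub_projAbove_le hA (ha n) h
  have h2 := norm_projAbove_apply_le A (a n) (f - A h)
  have h3 : projAbove A (a n) f - f
      = projAbove A (a n) (f - A h) - (A h - projAbove A (a n) (A h)) - (f - A h) := by
    rw [map_sub]; abel
  rw [h3]
  have h4 := hN n hn
  calc _ ≤ ‖projAbove A (a n) (f - A h)‖ + ‖A h - projAbove A (a n) (A h)‖ + ‖f - A h‖ :=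
        (norm_sub_le _ _).trans (add_le_add_left (norm_sub_le _ _) _)
    _ < ε := by linarith

end SpectralProjections

/-! ### The form domain, the resolvent and strong convergence of the spectral decomposition. -/

variable {n₁ n₂ : ℕ}

lemma continuous_eval (ϰ : ℕ) (V : Potential) :
    Continuous (V.eval ϰ : EuclideanSpace ℝ (Fin n₁) → ℝ) := by
  cases V with
  | radial =>
    change Continuous fun x' : EuclideanSpace ℝ (Fin n₁) => ‖x'‖ ^ (2 * ϰ)
    fun_prop
  | separable =>
    change Continuous fun x' : EuclideanSpace ℝ (Fin n₁) => ∑ i, x' i ^ (2 * ϰ)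
    fun_prop

lemma continuous_fderiv_apply_of_smooth {φ : Space n₁ n₂ → ℂ} (hφ : ContDiff ℝ ∞ φ)
    (v : Space n₁ n₂) : Continuous fun x => fderiv ℝ φ x v :=
  (hφ.continuous_fderiv (by simp)).clm_apply continuous_const

lemma exists_mem_testTriples (ϰ : ℕ) (V : Potential) {φ : Space n₁ n₂ → ℂ}
    (hφ : ContDiff ℝ ∞ φ) (hc : HasCompactSupport φ) :
    ∃ w ∈ testTriples ϰ V, w none =ᵐ[volume] φ := by
  have h0 : MemLp φ 2 volume := hφ.continuous.memLp_of_hasCompactSupport hc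
  have h1 : ∀ i, MemLp (partialFst i φ) 2 volume := fun i =>
    (continuous_fderiv_apply_of_smooth hφ _).memLp_of_hasCompactSupport (hc.fderiv_apply ℝ _)
  have h2 : ∀ k, MemLp (fun x => (Real.sqrt (V.eval ϰ x.1) : ℂ) * partialSnd k φ x) 2
      volume := fun k => by
    refine Continuous.memLp_of_hasCompactSupport ?_ ?_
    · refine Continuous.mul ?_ (continuous_fderiv_apply_of_smooth hφ _)
      exact Complex.continuous_ofReal.comp
        (Real.continuous_sqrt.comp ((continuous_eval ϰ V).comp continuous_fst))
    · exact (hc.fderiv_apply ℝ _).mul_left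
  refine ⟨WithLp.toLp 2 fun o => match o with
    | none => h0.toLp _
    | some (Sum.inl i) => (h1 i).toLp _
    | some (Sum.inr k) => (h2 k).toLp _, ⟨φ, hφ, hc, ?_, ?_, ?_⟩, ?_⟩
  · exact h0.coeFn_toLp
  · exact fun i => (h1 i).coeFn_toLp
  · exact fun k => (h2 k).coeFn_toLp
  · exact h0.coeFn_toLp

/-- The image contains the classes of all smooth functions with compact support. -/
lemma denseRange_formEmbedding (ϰ : ℕ) (V : Potential) :
    DenseRange (formEmbedding n₁ n₂ ϰ V) := by
  have hd := Lp.dense_hasCompactSupport_contDiff (E := Space n₁ n₂) (F := ℂ) (p := 2)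
    (μ := volume) (by simp)
  refine hd.mono ?_
  rintro f ⟨φ, hfφ, hc, hφ⟩
  obtain ⟨w, hw, hwφ⟩ := exists_mem_testTriples ϰ V hφ hc
  refine ⟨⟨w, Submodule.le_topologicalClosure _ (Submodule.subset_span hw)⟩, ?_⟩
  exact Lp.ext (hwφ.trans hfφ.symm)

lemma grushinResolvent_nonneg (n₁ n₂ ϰ : ℕ) (V : Potential) :
    0 ≤ grushinResolvent n₁ n₂ ϰ V :=
  (ContinuousLinearMap.nonneg_iff_isPositive _).2
    (ContinuousLinearMap.isPositive_self_comp_adjoint _)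

/-- With `A = J J*`, a vector `f` orthogonal to the range has `0 = ⟪A f, f⟫ = ‖J* f‖²`, so `f` is
orthogonal to the dense range of `J`. This excludes spectral mass of `A` at `0`, the point that
corresponds to `G_ϰ = ∞`. -/
lemma denseRange_grushinResolvent (n₁ n₂ ϰ : ℕ) (V : Potential) :
    DenseRange (grushinResolvent n₁ n₂ ϰ V) := by
  set J := formEmbedding n₁ n₂ ϰ V with hJ
  set A := grushinResolvent n₁ n₂ ϰ V with hA
  have hsa : IsSelfAdjoint A := .of_nonneg (grushinResolvent_nonneg n₁ n₂ ϰ V)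
  have hJd : (LinearMap.range J.toLinearMap).topologicalClosure = ⊤ :=
    Submodule.dense_iff_topologicalClosure_eq_top.1 (denseRange_formEmbedding ϰ V)
  have hJ' := (Submodule.topologicalClosure_eq_top_iff).1 hJd
  have key : (LinearMap.range A.toLinearMap)ᗮ = ⊥ := by
    rw [Submodule.eq_bot_iff]
    intro f hf
    have h0 : inner ℂ (A f) f = 0 := (Submodule.mem_orthogonal _ _).1 hf _ ⟨f, rfl⟩
    have h1 : (ContinuousLinearMap.adjoint J) f = 0 := by
      rw [← inner_self_eq_zero (𝕜 := ℂ), ContinuousLinearMap.adjoint_inner_right]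
      exact h0
    have h2 : f ∈ (LinearMap.range J.toLinearMap)ᗮ := by
      rw [Submodule.mem_orthogonal]
      rintro _ ⟨w, rfl⟩
      change inner ℂ (J w) f = 0
      rw [← ContinuousLinearMap.adjoint_inner_right, h1, inner_zero_right]
    rwa [hJ', Submodule.mem_bot] at h2
  exact Submodule.dense_iff_topologicalClosure_eq_top.2
    ((Submodule.topologicalClosure_eq_top_iff).2 key)

open Filter Topology in
/-- The spectral projections `χ_j(G_ϰ)` sum strongly to the identity. -/
lemma tendsto_sum_chi (n₁ n₂ ϰ : ℕ) (V : Potential) (f : L2 n₁ n₂) :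
    Tendsto (fun N => ∑ j ∈ Finset.range N, chi n₁ n₂ ϰ V j f) atTop (𝓝 f) := by
  -- The sum over `j ≤ N` telescopes to the projection `1_{[0, 2^N)}(G_ϰ)`.
  have hsum : ∀ N, ∑ j ∈ Finset.range (N + 1), chi n₁ n₂ ϰ V j f
      = projAbove (grushinResolvent n₁ n₂ ϰ V) (1 + 2 ^ N)⁻¹ f := by
    intro N
    induction N with
    | zero => simp [chi, spectralProj]
    | succ N ih =>
      rw [Finset.sum_range_succ, ih]
      simp [chi, spectralProj]
  rw [← tendsto_add_atTop_iff_nat 1]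
  simp_rw [hsum]
  refine tendsto_projAbove (grushinResolvent_nonneg _ _ _ _) (denseRange_grushinResolvent _ _ _ _)
    (fun n => by positivity) ?_ f
  refine tendsto_inv_atTop_zero.comp (tendsto_atTop_add_const_left _ _ ?_)
  exact tendsto_pow_atTop_atTop_of_one_lt one_lt_two

/-! ### Calderón–Zygmund decomposition along a refining sequence of countable partitions -/

section CalderonZygmund

open scoped ENNReal
open Set

variable {X ι : Type*}

/-- The cell of `x` in the `n`-th partition, two points being in the same cell if they have the
same index. -/
def cell (idx : ℕ → X → ι) (n : ℕ) (x : X) : Set X := {y | idx n y = idx n x}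

/-- The partitions get finer. -/
def Refining (idx : ℕ → X → ι) : Prop :=
  ∀ n x y, idx (n + 1) y = idx (n + 1) x → idx n y = idx n x

lemma Refining.le {idx : ℕ → X → ι} (h : Refining idx) {m n : ℕ} (hmn : m ≤ n) {x y : X}
    (hxy : idx n y = idx n x) : idx m y = idx m x := by
  induction n, hmn using Nat.le_induction with
  | base => exact hxy
  | succ n _ ih => exact ih (h n x y hxy)

lemma cell_congr {idx : ℕ → X → ι} {n : ℕ} {x y : X} (h : idx n y = idx n x) :
    cell idx n y = cell idx n x := by
  simp [cell, h]

variable [MeasurableSpace X]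

/-- The mean of `‖f‖` over the cell exceeds `α`. -/
def IsHeavy (μ : Measure X) (idx : ℕ → X → ι) (f : X → ℂ) (α : ℝ≥0∞) (n : ℕ) (x : X) : Prop :=
  α * μ (cell idx n x) < ∫⁻ y in cell idx n x, ‖f y‖ₑ ∂μ

/-- The cells that are heavy, no coarser cell around being so. -/
def stoppingCell (μ : Measure X) (idx : ℕ → X → ι) (f : X → ℂ) (α : ℝ≥0∞) (p : ℕ × ι) : Set X :=
  {x | idx p.1 x = p.2 ∧ IsHeavy μ idx f α p.1 x ∧ ∀ m < p.1, ¬ IsHeavy μ idx f α m x}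

open Classical in
/-- The good part of `f`: its mean on each stopping cell, and `f` outside. -/
def goodPart (μ : Measure X) (idx : ℕ → X → ι) (f : X → ℂ) (α : ℝ≥0∞) (x : X) : ℂ :=
  if h : ∃ p, x ∈ stoppingCell μ idx f α p then ⨍ y in stoppingCell μ idx f α h.choose, f y ∂μ
  else f x

variable {μ : Measure X} {idx : ℕ → X → ι} {f : X → ℂ} {α D : ℝ≥0∞}

lemma isHeavy_congr {n : ℕ} {x y : X} (h : idx n y = idx n x) :
    IsHeavy μ idx f α n y ↔ IsHeavy μ idx f α n x := by
  rw [IsHeavy, IsHeavy, cell_congr h]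

/-- Heaviness is constant on cells, and a cell lies in a single cell of each coarser partition, so
the stopping condition is also constant on the cell. A stopping set is therefore empty or a full
cell. -/
lemma stoppingCell_eq_cell (hR : Refining idx) {p : ℕ × ι} {x : X}
    (hx : x ∈ stoppingCell μ idx f α p) : stoppingCell μ idx f α p = cell idx p.1 x := by
  obtain ⟨h1, h2, h3⟩ := hx
  ext y
  refine ⟨fun hy => hy.1.trans h1.symm, fun hy => ⟨hy.trans h1, ?_, fun m hm => ?_⟩⟩
  · rwa [isHeavy_congr hy]
  · rw [isHeavy_congr (hR.le hm.le hy)]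
    exact h3 m hm

lemma pairwise_disjoint_stoppingCell :
    Pairwise (Function.onFun Disjoint (stoppingCell μ idx f α)) := by
  intro p q hpq
  rw [Function.onFun, Set.disjoint_left]
  rintro x ⟨h1, h2, h3⟩ ⟨h1', h2', h3'⟩
  have : p.1 = q.1 := by
    rcases lt_trichotomy p.1 q.1 with h | h | h
    · exact (h3' _ h h2).elim
    · exact h
    · exact (h3 _ h h2').elim
  refine hpq (Prod.ext this ?_)
  rw [← h1, ← h1', this]

lemma measurableSet_stoppingCell (hR : Refining idx) (hm : ∀ n x, MeasurableSet (cell idx n x))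
    (p : ℕ × ι) : MeasurableSet (stoppingCell μ idx f α p) := by
  rcases (stoppingCell μ idx f α p).eq_empty_or_nonempty with h | ⟨x, hx⟩
  · rw [h]; exact .empty
  · rw [stoppingCell_eq_cell hR hx]; exact hm _ _

lemma measure_stoppingCell_ne_top (hR : Refining idx) (hfin : ∀ n x, μ (cell idx n x) ≠ ⊤)
    (p : ℕ × ι) : μ (stoppingCell μ idx f α p) ≠ ⊤ := by
  rcases (stoppingCell μ idx f α p).eq_empty_or_nonempty with h | ⟨x, hx⟩
  · simp [h]
  · rw [stoppingCell_eq_cell hR hx]; exact hfin _ _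

lemma mul_measure_stoppingCell_le (hR : Refining idx) (p : ℕ × ι) :
    α * μ (stoppingCell μ idx f α p) ≤ ∫⁻ y in stoppingCell μ idx f α p, ‖f y‖ₑ ∂μ := by
  rcases (stoppingCell μ idx f α p).eq_empty_or_nonempty with h | ⟨x, hx⟩
  · simp [h]
  · rw [stoppingCell_eq_cell hR hx]; exact hx.2.1.le

/-- The parent of a stopping cell is not heavy and is at most `D` times as large. Having no heavy
cell at level `0` guarantees that the parent exists. -/
lemma lintegral_stoppingCell_le (hR : Refining idx)
    (hD : ∀ n x, μ (cell idx n x) ≤ D * μ (cell idx (n + 1) x))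
    (h0 : ∀ x, ¬ IsHeavy μ idx f α 0 x) (p : ℕ × ι) :
    ∫⁻ y in stoppingCell μ idx f α p, ‖f y‖ₑ ∂μ ≤ D * α * μ (stoppingCell μ idx f α p) := by
  rcases (stoppingCell μ idx f α p).eq_empty_or_nonempty with h | ⟨x, hx⟩
  · simp [h]
  rw [stoppingCell_eq_cell hR hx]
  obtain ⟨h1, h2, h3⟩ := hx
  obtain ⟨n, i⟩ := p
  cases n with
  | zero => exact (h0 x h2).elim
  | succ n =>
    have h4 := not_lt.1 (h3 n (Nat.lt_succ_self n))
    calc ∫⁻ y in cell idx (n + 1) x, ‖f y‖ₑ ∂μ ≤ ∫⁻ y in cell idx n x, ‖f y‖ₑ ∂μ :=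
          lintegral_mono_set fun y hy => hR n x y hy
      _ ≤ α * μ (cell idx n x) := h4
      _ ≤ α * (D * μ (cell idx (n + 1) x)) := by gcongr; exact hD n x
      _ = D * α * μ (cell idx (n + 1) x) := by ring

lemma exists_mem_stoppingCell {x : X} {n : ℕ} (h : IsHeavy μ idx f α n x) :
    ∃ p, x ∈ stoppingCell μ idx f α p := by
  classical
  have h' : ∃ n, IsHeavy μ idx f α n x := ⟨n, h⟩
  exact ⟨(Nat.find h', idx (Nat.find h') x), rfl, Nat.find_spec h', fun m hm => Nat.find_min h' hm⟩

/-- Stopping cells are disjoint, so the arbitrary choice in the definition is the only possible one.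
-/
lemma goodPart_of_mem {p : ℕ × ι} {x : X} (hx : x ∈ stoppingCell μ idx f α p) :
    goodPart μ idx f α x = ⨍ y in stoppingCell μ idx f α p, f y ∂μ := by
  have h : ∃ p, x ∈ stoppingCell μ idx f α p := ⟨p, hx⟩
  rw [goodPart, dif_pos h]
  have : h.choose = p := by
    by_contra hne
    exact Set.disjoint_left.1 (pairwise_disjoint_stoppingCell hne) h.choose_spec hx
  rw [this]

lemma goodPart_of_notMem {x : X} (hx : x ∉ ⋃ p, stoppingCell μ idx f α p) :
    goodPart μ idx f α x = f x := by
  rw [goodPart, dif_neg (by simpa using hx)]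

/-- The product form stays valid on null sets, where the average is a default value. -/
lemma enorm_setAverage_mul_le (s : Set X) (hs : μ s ≠ ⊤) :
    ‖⨍ y in s, f y ∂μ‖ₑ * μ s ≤ ∫⁻ y in s, ‖f y‖ₑ ∂μ := by
  have h : ‖⨍ y in s, f y ∂μ‖ₑ ≤ ⨍⁻ y in s, ‖f y‖ₑ ∂μ := enorm_integral_le_lintegral_enorm _
  refine (mul_le_mul_left h _).trans ?_
  rw [setLAverage_eq, ENNReal.div_eq_inv_mul, mul_comm, ← mul_assoc]
  rcases eq_or_ne (μ s) 0 with h0 | h0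
  · simp [h0]
  · rw [ENNReal.mul_inv_cancel h0 hs, one_mul]

lemma lintegral_goodPart_stoppingCell_le (hR : Refining idx)
    (hm : ∀ n x, MeasurableSet (cell idx n x)) (hfin : ∀ n x, μ (cell idx n x) ≠ ⊤) (p : ℕ × ι) :
    ∫⁻ y in stoppingCell μ idx f α p, ‖goodPart μ idx f α y‖ₑ ∂μ
      ≤ ∫⁻ y in stoppingCell μ idx f α p, ‖f y‖ₑ ∂μ := by
  rw [setLIntegral_congr_fun (measurableSet_stoppingCell hR hm p)
    (g := fun _ => ‖⨍ y in stoppingCell μ idx f α p, f y ∂μ‖ₑ)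
    fun x hx => by simp only [goodPart_of_mem hx]]
  rw [setLIntegral_const]
  exact enorm_setAverage_mul_le _ (measure_stoppingCell_ne_top hR hfin p)

/-- On a stopping cell the parent bounds the average; elsewhere no cell around `x` is heavy. The
hypothesis `hlim` stands in for the differentiation theorem. -/
lemma enorm_goodPart_le (hR : Refining idx)
    (hpos : ∀ n x, μ (cell idx n x) ≠ 0) (hfin : ∀ n x, μ (cell idx n x) ≠ ⊤)
    (hD : ∀ n x, μ (cell idx n x) ≤ D * μ (cell idx (n + 1) x))
    (h0 : ∀ x, ¬ IsHeavy μ idx f α 0 x) (hD1 : 1 ≤ D)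
    (hlim : ∀ x, (∀ n, ¬ IsHeavy μ idx f α n x) → ‖f x‖ₑ ≤ α) (x : X) :
    ‖goodPart μ idx f α x‖ₑ ≤ D * α := by
  by_cases hx : ∃ p, x ∈ stoppingCell μ idx f α p
  · obtain ⟨p, hp⟩ := hx
    rw [goodPart_of_mem hp]
    have h1 := (enorm_setAverage_mul_le _ (measure_stoppingCell_ne_top hR hfin p)).trans
      (lintegral_stoppingCell_le hR hD h0 p)
    refine (ENNReal.mul_le_mul_iff_left ?_ (measure_stoppingCell_ne_top hR hfin p)).1 h1
    rw [stoppingCell_eq_cell hR hp]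
    exact hpos _ _
  · rw [goodPart_of_notMem (by simpa using hx)]
    refine (hlim x fun n hn => hx (exists_mem_stoppingCell hn)).trans ?_
    exact le_mul_of_one_le_left' hD1

lemma setIntegral_sub_goodPart (hR : Refining idx)
    (hm : ∀ n x, MeasurableSet (cell idx n x)) (hfin : ∀ n x, μ (cell idx n x) ≠ ⊤) (p : ℕ × ι) :
    ∫ y in stoppingCell μ idx f α p, (f y - goodPart μ idx f α y) ∂μ = 0 := by
  rw [setIntegral_congr_fun (measurableSet_stoppingCell hR hm p)
    (g := fun x => f x - ⨍ y in stoppingCell μ idx f α p, f y ∂μ)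
    fun x hx => by simp only [goodPart_of_mem hx]]
  have : IsFiniteMeasure (μ.restrict (stoppingCell μ idx f α p)) :=
    ⟨by rw [Measure.restrict_apply_univ]
        exact (measure_stoppingCell_ne_top hR hfin p).lt_top⟩
  exact integral_sub_average _ _

variable [Countable ι]

lemma aestronglyMeasurable_goodPart (hR : Refining idx)
    (hm : ∀ n x, MeasurableSet (cell idx n x)) (hf : AEStronglyMeasurable f μ) :
    AEStronglyMeasurable (goodPart μ idx f α) μ := by
  have hU : MeasurableSet (⋃ p, stoppingCell μ idx f α p) :=
    .iUnion fun p => measurableSet_stoppingCell hR hm p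
  have h1 : AEStronglyMeasurable (goodPart μ idx f α)
      (μ.restrict (⋃ p, stoppingCell μ idx f α p)) := by
    rw [aestronglyMeasurable_iUnion_iff]
    intro p
    refine (aestronglyMeasurable_const (b := ⨍ y in stoppingCell μ idx f α p, f y ∂μ)).congr ?_
    filter_upwards [ae_restrict_mem (measurableSet_stoppingCell hR hm p)] with x hx
    rw [goodPart_of_mem hx]
  have h2 : AEStronglyMeasurable (goodPart μ idx f α)
      (μ.restrict (⋃ p, stoppingCell μ idx f α p)ᶜ) := by
    refine hf.restrict.congr ?_
    filter_upwards [ae_restrict_mem hU.compl] with x hx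
    rw [goodPart_of_notMem hx]
  have := (aestronglyMeasurable_union_iff).2 ⟨h1, h2⟩
  rwa [Set.union_compl_self, Measure.restrict_univ] at this

lemma tsum_lintegral_stoppingCell_le (hR : Refining idx)
    (hm : ∀ n x, MeasurableSet (cell idx n x)) (F : X → ℝ≥0∞) :
    ∑' p, ∫⁻ y in stoppingCell μ idx f α p, F y ∂μ ≤ ∫⁻ y, F y ∂μ := by
  rw [← lintegral_iUnion (fun p => measurableSet_stoppingCell hR hm p)
    pairwise_disjoint_stoppingCell]
  exact setLIntegral_le_lintegral _ _

lemma lintegral_goodPart_le (hR : Refining idx)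
    (hm : ∀ n x, MeasurableSet (cell idx n x)) (hfin : ∀ n x, μ (cell idx n x) ≠ ⊤) :
    ∫⁻ y, ‖goodPart μ idx f α y‖ₑ ∂μ ≤ ∫⁻ y, ‖f y‖ₑ ∂μ := by
  have hU : MeasurableSet (⋃ p, stoppingCell μ idx f α p) :=
    .iUnion fun p => measurableSet_stoppingCell hR hm p
  rw [← lintegral_add_compl _ hU, ← lintegral_add_compl (fun y => ‖f y‖ₑ) hU]
  refine add_le_add ?_ (le_of_eq ?_)
  · rw [lintegral_iUnion (fun p => measurableSet_stoppingCell hR hm p)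
      pairwise_disjoint_stoppingCell, lintegral_iUnion
      (fun p => measurableSet_stoppingCell hR hm p) pairwise_disjoint_stoppingCell]
    exact ENNReal.tsum_le_tsum fun p => lintegral_goodPart_stoppingCell_le hR hm hfin p
  · exact setLIntegral_congr_fun hU.compl fun x hx => by simp only [goodPart_of_notMem hx]

end CalderonZygmund

/-! ### Dyadic cubes adapted to the Grushin geometry -/

section Dyadic

variable {n₁ n₂ : ℕ}

/-- The coarser floor is the integer quotient of the finer one by `2^(b-a)`. -/
lemma floor_zpow_mul_congr {a b : ℤ} (hab : a ≤ b) {s t : ℝ}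
    (h : ⌊(2 : ℝ) ^ b * s⌋ = ⌊(2 : ℝ) ^ b * t⌋) : ⌊(2 : ℝ) ^ a * s⌋ = ⌊(2 : ℝ) ^ a * t⌋ := by
  obtain ⟨n, rfl⟩ := Int.le.dest hab
  have key : ∀ u : ℝ, ⌊(2 : ℝ) ^ a * u⌋ = ⌊(2 : ℝ) ^ (a + n) * u⌋ / ((2 ^ n : ℕ) : ℤ) := by
    intro u
    rw [← Int.floor_div_natCast, zpow_add₀ two_ne_zero, zpow_natCast]
    congr 1
    push_cast
    field_simp
  rw [key s, key t, h]

lemma abs_sub_le_of_floor_eq {b : ℤ} {s t : ℝ} (h : ⌊(2 : ℝ) ^ b * s⌋ = ⌊(2 : ℝ) ^ b * t⌋) :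
    |s - t| ≤ 2 ^ (-b) := by
  have h1 := Int.abs_sub_lt_one_of_floor_eq_floor h
  have hb : (0 : ℝ) < 2 ^ b := by positivity
  rw [← mul_sub, abs_mul, abs_of_pos hb] at h1
  rw [zpow_neg, ← one_div, le_div_iff₀ hb, mul_comm]
  exact h1.le

lemma volume_floor_eq (b : ℤ) (t : ℝ) :
    volume {s : ℝ | ⌊(2 : ℝ) ^ b * s⌋ = ⌊(2 : ℝ) ^ b * t⌋} = ENNReal.ofReal (2 ^ (-b)) := by
  have hb : (0 : ℝ) < 2 ^ b := by positivity
  have : {s : ℝ | ⌊(2 : ℝ) ^ b * s⌋ = ⌊(2 : ℝ) ^ b * t⌋}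
      = Set.Ico ((⌊(2 : ℝ) ^ b * t⌋ : ℝ) / 2 ^ b) (((⌊(2 : ℝ) ^ b * t⌋ : ℝ) + 1) / 2 ^ b) := by
    ext s
    rw [Set.mem_ofPred_eq, Int.floor_eq_iff, Set.mem_Ico, div_le_iff₀ hb, lt_div_iff₀ hb,
      mul_comm s]
  rw [this, Real.volume_Ico, zpow_neg]
  congr 1
  field_simp
  ring

lemma measurableSet_floor_eq (b : ℤ) (c : ℤ) : MeasurableSet {s : ℝ | ⌊(2 : ℝ) ^ b * s⌋ = c} :=
  measurableSet_eq_fun (by fun_prop) measurable_const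

lemma volume_euclidean_pi {n : ℕ} (S : Fin n → Set ℝ) (hS : ∀ i, MeasurableSet (S i)) :
    volume {v : EuclideanSpace ℝ (Fin n) | ∀ i, v i ∈ S i} = ∏ i, volume (S i) := by
  have h := (EuclideanSpace.volume_preserving_symm_measurableEquiv_toLp (Fin n)).measure_preimage
    (MeasurableSet.univ_pi hS).nullMeasurableSet
  rw [volume_pi_pi] at h
  rw [← h]
  congr 1
  ext v
  simp

lemma euclidean_norm_le {n : ℕ} {v : EuclideanSpace ℝ (Fin n)} {c : ℝ}
    (h : ∀ i, |v i| ≤ c) : ‖v‖ ≤ n * c := by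
  calc ‖v‖ = ‖∑ i, v i • EuclideanSpace.basisFun (Fin n) ℝ i‖ := by
        conv_lhs => rw [← (EuclideanSpace.basisFun (Fin n) ℝ).sum_repr v]
        simp
    _ ≤ ∑ i, ‖v i • EuclideanSpace.basisFun (Fin n) ℝ i‖ := norm_sum_le _ _
    _ ≤ ∑ _i : Fin n, c := by
        refine Finset.sum_le_sum fun i _ => ?_
        rw [norm_smul, (EuclideanSpace.basisFun (Fin n) ℝ).norm_eq_one, mul_one]
        exact h i
    _ = n * c := by simp

lemma abs_apply_le_norm {n : ℕ} (v : EuclideanSpace ℝ (Fin n)) (i : Fin n) : |v i| ≤ ‖v‖ := by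
  simpa using PiLp.norm_apply_le v i

/-- `2^k x'` lies in the half-open cube `[-2^n, 2^n)^{n₁}`. -/
def InBox (k : ℤ) (n : ℕ) (x' : EuclideanSpace ℝ (Fin n₁)) : Prop :=
  ∀ i, -(2 : ℝ) ^ n ≤ 2 ^ k * x' i ∧ 2 ^ k * x' i < 2 ^ n

lemma exists_inBox (k : ℤ) (x' : EuclideanSpace ℝ (Fin n₁)) : ∃ n, InBox k n x' := by
  obtain ⟨n, hn⟩ := pow_unbounded_of_one_lt ((2 : ℝ) ^ k * ‖x'‖) one_lt_two
  refine ⟨n, fun i => ?_⟩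
  have h1 : |(2 : ℝ) ^ k * x' i| < 2 ^ n := by
    rw [abs_mul, abs_of_pos (by positivity : (0 : ℝ) < 2 ^ k)]
    refine lt_of_le_of_lt ?_ hn
    gcongr
    exact abs_apply_le_norm _ _
  exact ⟨(abs_lt.1 h1).1.le, (abs_lt.1 h1).2⟩

lemma InBox.mono {k : ℤ} {m n : ℕ} (hmn : m ≤ n) {x' : EuclideanSpace ℝ (Fin n₁)}
    (h : InBox k m x') : InBox k n x' := fun i =>
  have h2 : (2 : ℝ) ^ m ≤ 2 ^ n := pow_le_pow_right₀ one_le_two hmn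
  ⟨by linarith [(h i).1], by linarith [(h i).2]⟩

lemma inBox_iff_floor {k : ℤ} {n : ℕ} {x' : EuclideanSpace ℝ (Fin n₁)} :
    InBox k n x' ↔ ∀ i, -(2 : ℤ) ^ n ≤ ⌊(2 : ℝ) ^ k * x' i⌋ ∧ ⌊(2 : ℝ) ^ k * x' i⌋ < 2 ^ n := by
  refine forall_congr' fun i => and_congr ?_ ?_
  · rw [Int.le_floor]; push_cast; rfl
  · rw [Int.floor_lt]; push_cast; rfl

lemma inBox_succ_iff {k : ℤ} {n : ℕ} {x' : EuclideanSpace ℝ (Fin n₁)} :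
    InBox (k + 1) (n + 1) x' ↔ InBox k n x' := by
  refine forall_congr' fun i => ?_
  rw [zpow_add_one₀ two_ne_zero, pow_succ]
  constructor <;> rintro ⟨h1, h2⟩ <;> constructor <;> linarith

open Classical in
/-- The least `m ∈ ℕ` with `2^k x' ∈ [-2^m, 2^m)^{n₁}`. -/
def dyadicSize (k : ℤ) (x' : EuclideanSpace ℝ (Fin n₁)) : ℕ := Nat.find (exists_inBox k x')

lemma dyadicSize_le_iff {k : ℤ} {n : ℕ} {x' : EuclideanSpace ℝ (Fin n₁)} :
    dyadicSize k x' ≤ n ↔ InBox k n x' := by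
  classical
  rw [dyadicSize, Nat.find_le_iff]
  exact ⟨fun ⟨m, hm, h⟩ => h.mono hm, fun h => ⟨n, le_rfl, h⟩⟩

/-- The cubes `[-2^m, 2^m)^{n₁}` are unions of unit cells of the integer grid. This is why half-open
boxes are used rather than the norm. -/
lemma dyadicSize_congr {k : ℤ} {x' y' : EuclideanSpace ℝ (Fin n₁)}
    (h : ∀ i, ⌊(2 : ℝ) ^ k * y' i⌋ = ⌊(2 : ℝ) ^ k * x' i⌋) : dyadicSize k y' = dyadicSize k x' := by
  refine eq_of_forall_ge_iff fun n => ?_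
  rw [dyadicSize_le_iff, dyadicSize_le_iff, inBox_iff_floor, inBox_iff_floor]
  simp only [h]

/-- This bound makes the exponent in `sndScale` nondecreasing in `k`, hence the partitions nested.
-/
lemma dyadicSize_succ_le (k : ℤ) (x' : EuclideanSpace ℝ (Fin n₁)) :
    dyadicSize (k + 1) x' ≤ dyadicSize k x' + 1 := by
  rw [dyadicSize_le_iff, inBox_succ_iff, ← dyadicSize_le_iff]

/-- This bound limits the growth of `sndScale` to `1 + ϰ` per step, hence the volume ratio of
consecutive cubes. -/
lemma le_dyadicSize_succ (k : ℤ) (x' : EuclideanSpace ℝ (Fin n₁)) :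
    dyadicSize k x' ≤ dyadicSize (k + 1) x' := by
  rw [dyadicSize_le_iff, ← inBox_succ_iff, ← dyadicSize_le_iff]
  exact Nat.le_succ _

/-- The size of `x'` at the scale `2^{-k}`, comparable to `max(2^{-k}, |x'|)`. -/
def dyadicRho (k : ℤ) (x' : EuclideanSpace ℝ (Fin n₁)) : ℝ := 2 ^ ((dyadicSize k x' : ℤ) - k)

/-- The sides in the second variable of the dyadic cube of scale `2^{-k}` around `x` are `2^{-b}`
with this `b`. -/
def sndScale (ϰ : ℕ) (k : ℤ) (x' : EuclideanSpace ℝ (Fin n₁)) : ℤ :=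
  k + ϰ * (k - dyadicSize k x')

lemma two_zpow_neg_sndScale (ϰ : ℕ) (k : ℤ) (x' : EuclideanSpace ℝ (Fin n₁)) :
    (2 : ℝ) ^ (-sndScale ϰ k x') = 2 ^ (-k) * dyadicRho k x' ^ ϰ := by
  rw [sndScale, dyadicRho, ← zpow_natCast, ← zpow_mul, ← zpow_add₀ two_ne_zero]
  congr 1
  ring

lemma sndScale_le_succ (ϰ : ℕ) (k : ℤ) (x' : EuclideanSpace ℝ (Fin n₁)) :
    sndScale ϰ k x' ≤ sndScale ϰ (k + 1) x' := by
  have h : ((dyadicSize (k + 1) x' : ℕ) : ℤ) ≤ dyadicSize k x' + 1 := by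
    exact_mod_cast dyadicSize_succ_le k x'
  unfold sndScale
  have : (ϰ : ℤ) * (k - dyadicSize k x') ≤ ϰ * (k + 1 - dyadicSize (k + 1) x') := by
    gcongr ?_ * ?_
    linarith
  linarith

lemma sndScale_succ_le (ϰ : ℕ) (k : ℤ) (x' : EuclideanSpace ℝ (Fin n₁)) :
    sndScale ϰ (k + 1) x' ≤ sndScale ϰ k x' + (1 + ϰ) := by
  have h : ((dyadicSize k x' : ℕ) : ℤ) ≤ dyadicSize (k + 1) x' := by
    exact_mod_cast le_dyadicSize_succ k x'
  unfold sndScale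
  have : (ϰ : ℤ) * (k + 1 - dyadicSize (k + 1) x') ≤ ϰ * (k + 1 - dyadicSize k x') := by
    gcongr ?_ * ?_
    linarith
  linarith

/-- The index of the dyadic cube of scale `2^{-(k₀+n)}` containing `x`. -/
def dyadicIdx (ϰ : ℕ) (k₀ : ℤ) (n : ℕ) (x : Space n₁ n₂) : (Fin n₁ → ℤ) × (Fin n₂ → ℤ) :=
  (fun i => ⌊(2 : ℝ) ^ (k₀ + n) * x.1 i⌋,
    fun l => ⌊(2 : ℝ) ^ (sndScale ϰ (k₀ + n) x.1) * x.2 l⌋)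

/-- The dyadic cube of scale `2^{-k}` containing `x`. -/
def cube (ϰ : ℕ) (k : ℤ) (x : Space n₁ n₂) : Set (Space n₁ n₂) :=
  {y | ∀ i, ⌊(2 : ℝ) ^ k * y i⌋ = ⌊(2 : ℝ) ^ k * x.1 i⌋} ×ˢ
    {y | ∀ l, ⌊(2 : ℝ) ^ (sndScale ϰ k x.1) * y l⌋ = ⌊(2 : ℝ) ^ (sndScale ϰ k x.1) * x.2 l⌋}

/-- The index of `y` uses the scale determined by `y'`. Equality of the first components forces
equal dyadic sizes, so both points use the same scale in `x''` and the cell is a genuine product. -/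
lemma dyadicIdx_eq_iff {ϰ : ℕ} {k₀ : ℤ} {n : ℕ} {x y : Space n₁ n₂} :
    dyadicIdx ϰ k₀ n y = dyadicIdx ϰ k₀ n x ↔ y ∈ cube ϰ (k₀ + n) x := by
  simp only [dyadicIdx, Prod.mk.injEq, funext_iff, cube, Set.mem_prod, Set.mem_ofPred_eq]
  refine and_congr_right fun h => ?_
  have : sndScale ϰ (k₀ + n) y.1 = sndScale ϰ (k₀ + n) x.1 := by
    rw [sndScale, sndScale, dyadicSize_congr h]
  rw [this]

lemma cell_dyadicIdx (ϰ : ℕ) (k₀ : ℤ) (n : ℕ) (x : Space n₁ n₂) :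
    cell (dyadicIdx ϰ k₀) n x = cube ϰ (k₀ + n) x :=
  Set.ext fun _ => dyadicIdx_eq_iff

lemma cube_succ_subset (ϰ : ℕ) (k : ℤ) (x : Space n₁ n₂) : cube ϰ (k + 1) x ⊆ cube ϰ k x :=
  fun _ hy => ⟨fun i => floor_zpow_mul_congr (by lia) (hy.1 i),
    fun l => floor_zpow_mul_congr (sndScale_le_succ ϰ k x.1) (hy.2 l)⟩

lemma refining_dyadicIdx (ϰ : ℕ) (k₀ : ℤ) :
    Refining (dyadicIdx ϰ k₀ : ℕ → Space n₁ n₂ → _) := by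
  intro n x y h
  rw [dyadicIdx_eq_iff] at h ⊢
  push_cast at h
  rw [← add_assoc] at h
  exact cube_succ_subset _ _ _ h

lemma measurableSet_cube (ϰ : ℕ) (k : ℤ) (x : Space n₁ n₂) : MeasurableSet (cube ϰ k x) := by
  refine MeasurableSet.prod ?_ ?_ <;> rw [Set.ofPred_forall] <;>
    exact MeasurableSet.iInter fun i => measurableSet_eq_fun (by fun_prop) measurable_const

/-- The volume of the dyadic cube. -/
def cubeVol (n₂ ϰ : ℕ) (k : ℤ) (x' : EuclideanSpace ℝ (Fin n₁)) : ℝ :=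
  (2 ^ (-k)) ^ n₁ * (2 ^ (-k) * dyadicRho k x' ^ ϰ) ^ n₂

lemma dyadicRho_pos (k : ℤ) (x' : EuclideanSpace ℝ (Fin n₁)) : 0 < dyadicRho k x' := by
  unfold dyadicRho; positivity

lemma cubeVol_pos (n₂ ϰ : ℕ) (k : ℤ) (x' : EuclideanSpace ℝ (Fin n₁)) : 0 < cubeVol n₂ ϰ k x' := by
  have := dyadicRho_pos k x'
  unfold cubeVol; positivity

lemma volume_cube (ϰ : ℕ) (k : ℤ) (x : Space n₁ n₂) :
    volume (cube ϰ k x) = ENNReal.ofReal (cubeVol n₂ ϰ k x.1) := by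
  have h : ∀ {n : ℕ} (b : ℤ) (w : EuclideanSpace ℝ (Fin n)),
      volume {v : EuclideanSpace ℝ (Fin n) | ∀ i, ⌊(2 : ℝ) ^ b * v i⌋ = ⌊(2 : ℝ) ^ b * w i⌋}
        = ENNReal.ofReal ((2 ^ (-b)) ^ n) := by
    intro n b w
    have := volume_euclidean_pi (fun i => {s : ℝ | ⌊(2 : ℝ) ^ b * s⌋ = ⌊(2 : ℝ) ^ b * w i⌋})
      fun i => measurableSet_floor_eq b _
    simp only [Set.mem_ofPred_eq, volume_floor_eq, Finset.prod_const, Finset.card_univ,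
      Fintype.card_fin] at this
    rw [this, ENNReal.ofReal_pow (by positivity)]
  rw [cube, Measure.volume_eq_prod, Measure.prod_prod, h, h, ← ENNReal.ofReal_mul (by positivity),
    cubeVol, two_zpow_neg_sndScale]

lemma volume_cube_ne_zero (ϰ : ℕ) (k : ℤ) (x : Space n₁ n₂) : volume (cube ϰ k x) ≠ 0 := by
  rw [volume_cube]
  simpa using cubeVol_pos n₂ ϰ k x.1

lemma volume_cube_ne_top (ϰ : ℕ) (k : ℤ) (x : Space n₁ n₂) : volume (cube ϰ k x) ≠ ⊤ := by
  rw [volume_cube]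
  exact ENNReal.ofReal_ne_top

lemma volume_cube_le_succ (ϰ : ℕ) (k : ℤ) (x : Space n₁ n₂) :
    volume (cube ϰ k x)
      ≤ ENNReal.ofReal (2 ^ n₁ * (2 ^ (1 + ϰ)) ^ n₂) * volume (cube ϰ (k + 1) x) := by
  rw [volume_cube, volume_cube, ← ENNReal.ofReal_mul (by positivity)]
  refine ENNReal.ofReal_le_ofReal ?_
  simp only [cubeVol, ← two_zpow_neg_sndScale]
  have h1 : (2 : ℝ) ^ (-k) = 2 * 2 ^ (-(k + 1)) := by
    rw [← zpow_one_add₀ two_ne_zero]; congr 1; ring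
  have h2 : (2 : ℝ) ^ (-sndScale ϰ k x.1) ≤ 2 ^ (1 + ϰ) * 2 ^ (-sndScale ϰ (k + 1) x.1) := by
    rw [← zpow_natCast, ← zpow_add₀ two_ne_zero]
    refine zpow_le_zpow_right₀ one_le_two ?_
    have := sndScale_succ_le ϰ k x.1
    push_cast
    linarith
  calc _ ≤ (2 * (2 : ℝ) ^ (-(k + 1))) ^ n₁ *
        (2 ^ (1 + ϰ) * 2 ^ (-sndScale ϰ (k + 1) x.1)) ^ n₂ := by
        rw [h1]; gcongr
    _ = _ := by rw [mul_pow, mul_pow]; ring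

lemma two_zpow_neg_le_dyadicRho (k : ℤ) (x' : EuclideanSpace ℝ (Fin n₁)) :
    2 ^ (-k) ≤ dyadicRho k x' :=
  zpow_le_zpow_right₀ one_le_two (by lia)

/-- The centre of the projection of the dyadic cube to the first variable. -/
def cubeCentre (k : ℤ) (x' : EuclideanSpace ℝ (Fin n₁)) : EuclideanSpace ℝ (Fin n₁) :=
  WithLp.toLp 2 fun i => 2 ^ (-k) * (⌊(2 : ℝ) ^ k * x' i⌋ + 1 / 2)

lemma abs_cubeCentre_apply_le (k : ℤ) (x' : EuclideanSpace ℝ (Fin n₁)) (i : Fin n₁) :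
    |cubeCentre k x' i| ≤ dyadicRho k x' := by
  obtain ⟨h1, h2⟩ := inBox_iff_floor.1 (dyadicSize_le_iff.1 (le_refl (dyadicSize k x'))) i
  have h1' : -(2 : ℝ) ^ dyadicSize k x' ≤ ⌊(2 : ℝ) ^ k * x' i⌋ := by exact_mod_cast h1
  have h2' : (⌊(2 : ℝ) ^ k * x' i⌋ : ℝ) + 1 ≤ 2 ^ dyadicSize k x' := by exact_mod_cast h2
  rw [dyadicRho, sub_eq_neg_add, zpow_add₀ two_ne_zero, zpow_natCast]
  simp only [cubeCentre]
  rw [abs_mul, abs_of_pos (by positivity : (0 : ℝ) < 2 ^ (-k))]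
  gcongr
  rw [abs_le]
  constructor <;> linarith

/-- Minimality of the dyadic size puts some coordinate outside the next smaller box. If the size is
`0` there is no smaller box, but a half-integer has modulus at least `1/2`. The centre, unlike other
points of the cube, thus always has a coordinate comparable to `ρ`. -/
lemma exists_dyadicRho_le (hn₁ : 1 ≤ n₁) (k : ℤ) (x' : EuclideanSpace ℝ (Fin n₁)) :
    ∃ i, dyadicRho k x' ≤ 2 * |cubeCentre k x' i| := by
  have key : ∀ i, (2 : ℝ) ^ dyadicSize k x' ≤ 2 * |(⌊(2 : ℝ) ^ k * x' i⌋ : ℝ) + 1 / 2| →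
      dyadicRho k x' ≤ 2 * |cubeCentre k x' i| := by
    intro i h
    rw [dyadicRho, sub_eq_neg_add, zpow_add₀ two_ne_zero, zpow_natCast]
    simp only [cubeCentre]
    rw [abs_mul, abs_of_pos (by positivity : (0 : ℝ) < 2 ^ (-k)), mul_left_comm]
    gcongr
  rcases h : dyadicSize k x' with _ | n
  · refine ⟨⟨0, hn₁⟩, key _ ?_⟩
    rw [h, pow_zero]
    rcases le_or_gt 0 ⌊(2 : ℝ) ^ k * x' ⟨0, hn₁⟩⌋ with hf | hf
    · have : (0 : ℝ) ≤ ⌊(2 : ℝ) ^ k * x' ⟨0, hn₁⟩⌋ := by exact_mod_cast hf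
      rw [abs_of_nonneg (by linarith)]; linarith
    · have : (⌊(2 : ℝ) ^ k * x' ⟨0, hn₁⟩⌋ : ℝ) + 1 ≤ 0 := by exact_mod_cast hf
      rw [abs_of_nonpos (by linarith)]; linarith
  · have hnot : ¬ InBox k n x' := by rw [← dyadicSize_le_iff, h]; simp
    rw [inBox_iff_floor] at hnot
    push Not at hnot
    obtain ⟨i, hi⟩ := hnot
    refine ⟨i, key i ?_⟩
    rw [h, pow_succ']
    rcases le_or_gt (-(2 : ℤ) ^ n) ⌊(2 : ℝ) ^ k * x' i⌋ with hf | hf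
    · have : (2 : ℝ) ^ n ≤ ⌊(2 : ℝ) ^ k * x' i⌋ := by exact_mod_cast hi hf
      have h0 : (0 : ℝ) < 2 ^ n := by positivity
      rw [abs_of_nonneg (by linarith)]; linarith
    · have : (⌊(2 : ℝ) ^ k * x' i⌋ : ℝ) + 1 ≤ -2 ^ n := by exact_mod_cast hf
      have h0 : (0 : ℝ) < 2 ^ n := by positivity
      rw [abs_of_nonpos (by linarith)]; linarith

lemma norm_cubeCentre_le (k : ℤ) (x' : EuclideanSpace ℝ (Fin n₁)) :
    ‖cubeCentre k x'‖ ≤ n₁ * dyadicRho k x' :=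
  euclidean_norm_le (abs_cubeCentre_apply_le k x')

lemma norm_fst_sub_cubeCentre_le {ϰ : ℕ} {k : ℤ} {x y : Space n₁ n₂} (hy : y ∈ cube ϰ k x) :
    ‖y.1 - cubeCentre k x.1‖ ≤ n₁ * 2 ^ (-k) := by
  refine euclidean_norm_le fun i => ?_
  have h := hy.1 i
  have h1 := Int.floor_le ((2 : ℝ) ^ k * y.1 i)
  have h2 := Int.lt_floor_add_one ((2 : ℝ) ^ k * y.1 i)
  rw [h] at h1 h2
  have h3 : (y.1 - cubeCentre k x.1) i
      = 2 ^ (-k) * (2 ^ k * y.1 i - (⌊(2 : ℝ) ^ k * x.1 i⌋ + 1 / 2)) := by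
    rw [mul_sub, ← mul_assoc, ← zpow_add₀ two_ne_zero]
    simp [cubeCentre]
  rw [h3, abs_mul, abs_of_pos (by positivity : (0 : ℝ) < 2 ^ (-k))]
  refine mul_le_of_le_one_right (by positivity) ?_
  rw [abs_le]
  constructor <;> linarith

lemma norm_snd_sub_le {ϰ : ℕ} {k : ℤ} {x y : Space n₁ n₂} (hy : y ∈ cube ϰ k x) :
    ‖y.2 - x.2‖ ≤ n₂ * (2 ^ (-k) * dyadicRho k x.1 ^ ϰ) := by
  rw [← two_zpow_neg_sndScale]
  exact euclidean_norm_le fun l => abs_sub_le_of_floor_eq (hy.2 l)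

lemma mem_cube_self (ϰ : ℕ) (k : ℤ) (x : Space n₁ n₂) : x ∈ cube ϰ k x :=
  ⟨fun _ => rfl, fun _ => rfl⟩

lemma norm_fst_sub_le {ϰ : ℕ} {k : ℤ} {x y : Space n₁ n₂} (hy : y ∈ cube ϰ k x) :
    ‖y.1 - x.1‖ ≤ n₁ * 2 ^ (-k) :=
  euclidean_norm_le fun i => abs_sub_le_of_floor_eq (hy.1 i)

lemma dyadicRho_le (hn₁ : 1 ≤ n₁) (k : ℤ) (x' : EuclideanSpace ℝ (Fin n₁)) :
    dyadicRho k x' ≤ 2 * (‖x'‖ + n₁ * 2 ^ (-k)) := by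
  obtain ⟨i, hi⟩ := exists_dyadicRho_le hn₁ k x'
  have h1 := abs_apply_le_norm (cubeCentre k x') i
  -- The second variable plays no role here, so it is taken in the zero-dimensional space.
  have h2 := norm_fst_sub_cubeCentre_le (mem_cube_self 0 k (x', (0 : EuclideanSpace ℝ (Fin 0))))
  have h3 := norm_sub_norm_le (cubeCentre k x') x'
  rw [norm_sub_rev] at h3
  simp only at h2
  linarith

/-- The cubes around `x` shrink to `x`. -/
lemma exists_cube_subset_ball (hn₁ : 1 ≤ n₁) (ϰ : ℕ) (k₀ : ℤ) (x : Space n₁ n₂) {δ : ℝ}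
    (hδ : 0 < δ) : ∃ n : ℕ, cube ϰ (k₀ + n) x ⊆ Metric.ball x δ := by
  have ht : Filter.Tendsto (fun n : ℕ => (2 : ℝ) ^ (-(k₀ + n))) Filter.atTop (nhds 0) := by
    have h := (tendsto_pow_atTop_nhds_zero_of_lt_one (r := (1 / 2 : ℝ)) (by norm_num)
      (by norm_num)).const_mul ((2 : ℝ) ^ (-k₀))
    rw [mul_zero] at h
    refine h.congr fun n => ?_
    rw [neg_add, zpow_add₀ two_ne_zero, zpow_neg _ (n : ℤ), zpow_natCast]
    simp
  have h1 : Filter.Tendsto (fun n : ℕ => (n₁ : ℝ) * 2 ^ (-(k₀ + n))) Filter.atTop (nhds 0) := by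
    simpa using ht.const_mul (n₁ : ℝ)
  have h2 : Filter.Tendsto (fun n : ℕ => (n₂ : ℝ) * ((2 : ℝ) ^ (-(k₀ + n)) *
      (2 * (‖x.1‖ + n₁ * 2 ^ (-(k₀ + n)))) ^ ϰ)) Filter.atTop (nhds 0) := by
    have := (ht.mul (((h1.const_add ‖x.1‖).const_mul 2).pow ϰ)).const_mul (n₂ : ℝ)
    simpa using this
  obtain ⟨n, hn1, hn2⟩ := ((h1.eventually (gt_mem_nhds hδ)).and
    (h2.eventually (gt_mem_nhds hδ))).exists
  refine ⟨n, fun y hy => ?_⟩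
  rw [mem_ball_iff_norm, Prod.norm_def, max_lt_iff]
  refine ⟨(norm_fst_sub_le hy).trans_lt hn1, ((norm_snd_sub_le hy).trans ?_).trans_lt hn2⟩
  have := dyadicRho_pos (k₀ + n) x.1
  gcongr
  exact dyadicRho_le hn₁ _ _

/-- The cubes of a fixed scale meeting a bounded set stay in a bounded set. -/
lemma exists_cube_subset_closedBall (hn₁ : 1 ≤ n₁) (ϰ : ℕ) (k : ℤ) (R : ℝ) :
    ∃ R', ∀ x : Space n₁ n₂, ‖x‖ ≤ R → cube ϰ k x ⊆ Metric.closedBall 0 R' := by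
  refine ⟨R + (n₁ * 2 ^ (-k) + n₂ * (2 ^ (-k) * (2 * (R + n₁ * 2 ^ (-k))) ^ ϰ)), fun x hx y hy => ?_⟩
  rw [mem_closedBall_zero_iff]
  have h0 := dyadicRho_pos k x.1
  have hx1 : ‖x.1‖ ≤ R := (norm_fst_le x).trans hx
  have h1 := norm_fst_sub_le hy
  have h2 : ‖y.2 - x.2‖ ≤ n₂ * (2 ^ (-k) * (2 * (R + n₁ * 2 ^ (-k))) ^ ϰ) := by
    refine (norm_snd_sub_le hy).trans ?_
    gcongr
    exact (dyadicRho_le hn₁ _ _).trans (by gcongr)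
  have h3 : ‖y - x‖ ≤ n₁ * 2 ^ (-k) + n₂ * (2 ^ (-k) * (2 * (R + n₁ * 2 ^ (-k))) ^ ϰ) := by
    rw [Prod.norm_def]
    refine max_le ?_ ?_
    · exact h1.trans (le_add_of_nonneg_right ((norm_nonneg _).trans h2))
    · exact h2.trans (le_add_of_nonneg_left (by positivity))
  have h4 := norm_sub_norm_le y x
  linarith

/-- One factor `2^n` comes from a side in the first variable and all other sides are at least `1`.
This uniform lower bound lets the stopping time start at a scale without heavy cubes. -/
lemma le_volume_cube (hn₁ : 1 ≤ n₁) (ϰ n : ℕ) (x : Space n₁ n₂) :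
    ENNReal.ofReal (2 ^ n) ≤ volume (cube ϰ (-(n : ℤ)) x) := by
  rw [volume_cube, cubeVol, neg_neg, zpow_natCast]
  refine ENNReal.ofReal_le_ofReal ?_
  have h1 : (1 : ℝ) ≤ 2 ^ n := one_le_pow₀ one_le_two
  have h2 : (1 : ℝ) ≤ dyadicRho (-(n : ℤ)) x.1 := by
    have := two_zpow_neg_le_dyadicRho (-(n : ℤ)) x.1
    rw [neg_neg, zpow_natCast] at this
    exact h1.trans this
  calc (2 : ℝ) ^ n = (2 ^ n) ^ 1 * 1 := by simp
    _ ≤ (2 ^ n) ^ n₁ * (2 ^ n * dyadicRho (-(n : ℤ)) x.1 ^ ϰ) ^ n₂ := by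
      refine mul_le_mul (pow_le_pow_right₀ h1 hn₁) ?_ zero_le_one (by positivity)
      exact one_le_pow₀ (one_le_mul_of_one_le_of_one_le h1 (one_le_pow₀ h2))

end Dyadic

/-! ### Geometry of the Grushin distance -/

section Geometry

variable {n₁ n₂ : ℕ} {ϰ : ℕ}

lemma grushinDist_comm (ϰ : ℕ) (x y : Space n₁ n₂) : grushinDist ϰ x y = grushinDist ϰ y x := by
  simp only [grushinDist, norm_sub_rev x.1, norm_sub_rev x.2, add_comm ‖x.1‖]

lemma rpow_root_le_iff {s t : ℝ} (hs : 0 ≤ s) (ht : 0 ≤ t) :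
    t ^ ((1 : ℝ) / (1 + ϰ)) ≤ s ↔ t ≤ s * s ^ ϰ := by
  rw [one_div, Real.rpow_inv_le_iff_of_pos ht hs (by positivity), ← pow_succ',
    ← Real.rpow_natCast, add_comm (1 : ℝ)]
  push_cast
  rfl

lemma rpow_root_lt_iff {s t : ℝ} (hs : 0 ≤ s) (ht : 0 ≤ t) :
    t ^ ((1 : ℝ) / (1 + ϰ)) < s ↔ t < s * s ^ ϰ := by
  rw [one_div, Real.rpow_inv_lt_iff_of_pos ht hs (by positivity), ← pow_succ',
    ← Real.rpow_natCast, add_comm (1 : ℝ)]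
  push_cast
  rfl

lemma norm_fst_sub_le_grushinDist (ϰ : ℕ) (x y : Space n₁ n₂) :
    ‖x.1 - y.1‖ ≤ grushinDist ϰ x y := by
  unfold grushinDist
  refine le_add_of_nonneg_right ?_
  split_ifs <;> positivity

lemma grushinDist_nonneg (ϰ : ℕ) (x y : Space n₁ n₂) : 0 ≤ grushinDist ϰ x y :=
  (norm_nonneg _).trans (norm_fst_sub_le_grushinDist ϰ x y)

lemma norm_snd_sub_lt_of_grushinDist_lt {x y : Space n₁ n₂} {R : ℝ} (hR : 0 < R)
    (h : grushinDist ϰ x y < R) :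
    ‖x.2 - y.2‖ < R * max (‖x.1‖ + ‖y.1‖) R ^ ϰ := by
  have hS : 0 ≤ ‖x.1‖ + ‖y.1‖ := by positivity
  have hM : 0 < max (‖x.1‖ + ‖y.1‖) R := lt_max_of_lt_right hR
  unfold grushinDist at h
  split_ifs at h with hc
  · rw [rpow_root_le_iff hS (norm_nonneg _)] at hc
    have h1 : ‖x.2 - y.2‖ / (‖x.1‖ + ‖y.1‖) ^ ϰ < R := by linarith [norm_nonneg (x.1 - y.1)]
    -- If `x' = y' = 0`, this branch of the distance only occurs for `x'' = y''`.
    rcases hS.eq_or_lt with h0 | h0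
    · rw [← h0, zero_mul] at hc
      exact hc.trans_lt (by positivity)
    · rw [div_lt_iff₀ (by positivity)] at h1
      refine h1.trans_le ?_
      gcongr
      exact le_max_left _ _
  · have h1 : ‖x.2 - y.2‖ ^ ((1 : ℝ) / (1 + ϰ)) < R := by linarith [norm_nonneg (x.1 - y.1)]
    rw [rpow_root_lt_iff hR.le (norm_nonneg _)] at h1
    refine h1.trans_le ?_
    gcongr
    exact le_max_right _ _

/-- Each of the two summands of the distance is below `R`; the same box governs both branches of its
definition. -/
lemma grushinDist_lt {x y : Space n₁ n₂} {R : ℝ} (hR : 0 < R) (h1 : ‖x.1 - y.1‖ < R)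
    (h2 : ‖x.2 - y.2‖ < R * max (‖x.1‖ + ‖y.1‖) R ^ ϰ) : grushinDist ϰ x y < 2 * R := by
  have hS : 0 ≤ ‖x.1‖ + ‖y.1‖ := by positivity
  set S := ‖x.1‖ + ‖y.1‖
  have key : (if ‖x.2 - y.2‖ ^ ((1 : ℝ) / (1 + ϰ)) ≤ S then ‖x.2 - y.2‖ / S ^ ϰ
      else ‖x.2 - y.2‖ ^ ((1 : ℝ) / (1 + ϰ))) < R := by
    split_ifs with hc
    · rcases le_or_gt R S with hRS | hRS
      · rw [max_eq_left hRS] at h2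
        have : 0 < S := hR.trans_le hRS
        rwa [div_lt_iff₀ (by positivity)]
      · rw [rpow_root_le_iff hS (norm_nonneg _)] at hc
        exact (div_le_of_le_mul₀ (by positivity) hS hc).trans_lt hRS
    · rcases le_or_gt R S with hRS | hRS
      · refine (hc ?_).elim
        rw [rpow_root_le_iff hS (norm_nonneg _)]
        rw [max_eq_left hRS] at h2
        exact h2.le.trans (by gcongr)
      · rw [max_eq_right hRS.le] at h2
        rwa [rpow_root_lt_iff hR.le (norm_nonneg _)]
  unfold grushinDist
  change ‖x.1 - y.1‖ + (if ‖x.2 - y.2‖ ^ ((1 : ℝ) / (1 + ϰ)) ≤ S then ‖x.2 - y.2‖ / S ^ ϰ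
      else ‖x.2 - y.2‖ ^ ((1 : ℝ) / (1 + ϰ))) < _
  linarith

/-- A box of size `R` around `z`, dilated by `c`. -/
def box (ϰ : ℕ) (c : ℝ) (z : Space n₁ n₂) (R : ℝ) : Set (Space n₁ n₂) :=
  Metric.closedBall z.1 (c * R) ×ˢ Metric.closedBall z.2 (c * (R * max R ‖z.1‖ ^ ϰ))

/-- The size of the boxes of radius `R` around `(x', x'')`. -/
def boxVol (n₂ ϰ : ℕ) (x' : EuclideanSpace ℝ (Fin n₁)) (R : ℝ) : ℝ :=
  R ^ n₁ * (R * max R ‖x'‖ ^ ϰ) ^ n₂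

lemma mem_box {c R : ℝ} {z y : Space n₁ n₂} :
    y ∈ box ϰ c z R ↔ ‖y.1 - z.1‖ ≤ c * R ∧ ‖y.2 - z.2‖ ≤ c * (R * max R ‖z.1‖ ^ ϰ) := by
  simp [box, dist_eq_norm]

lemma measurableSet_box (ϰ : ℕ) (c : ℝ) (z : Space n₁ n₂) (R : ℝ) :
    MeasurableSet (box ϰ c z R) :=
  Metric.isClosed_closedBall.measurableSet.prod Metric.isClosed_closedBall.measurableSet

lemma convex_box (ϰ : ℕ) (c : ℝ) (z : Space n₁ n₂) (R : ℝ) : Convex ℝ (box ϰ c z R) :=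
  (convex_closedBall _ _).prod (convex_closedBall _ _)

lemma boxVol_pos (n₂ ϰ : ℕ) (x' : EuclideanSpace ℝ (Fin n₁)) {R : ℝ} (hR : 0 < R) :
    0 < boxVol n₂ ϰ x' R := by
  have : 0 < max R ‖x'‖ := lt_max_of_lt_left hR
  unfold boxVol; positivity

/-- The volume of the product of the two unit balls. -/
def unitVol (n₁ n₂ : ℕ) : ℝ :=
  volume.real (Metric.ball (0 : EuclideanSpace ℝ (Fin n₁)) 1) *
    volume.real (Metric.ball (0 : EuclideanSpace ℝ (Fin n₂)) 1)

lemma unitVol_pos (n₁ n₂ : ℕ) : 0 < unitVol n₁ n₂ := by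
  have h : ∀ n : ℕ, 0 < volume.real (Metric.ball (0 : EuclideanSpace ℝ (Fin n)) 1) := fun n =>
    ENNReal.toReal_pos (Metric.measure_ball_pos _ _ one_pos).ne' measure_ball_lt_top.ne
  exact mul_pos (h n₁) (h n₂)

lemma volume_box {c R : ℝ} (hc : 0 ≤ c) (hR : 0 < R) (z : Space n₁ n₂) :
    volume (box ϰ c z R) = ENNReal.ofReal (c ^ (n₁ + n₂) * boxVol n₂ ϰ z.1 R * unitVol n₁ n₂) := by
  have hM : 0 < max R ‖z.1‖ := lt_max_of_lt_left hR
  rw [box, Measure.volume_eq_prod, Measure.prod_prod, Measure.addHaar_closedBall _ _ (by positivity),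
    Measure.addHaar_closedBall _ _ (by positivity), finrank_euclideanSpace_fin,
    finrank_euclideanSpace_fin, ← ofReal_measureReal measure_ball_lt_top.ne,
    ← ofReal_measureReal measure_ball_lt_top.ne, ← ENNReal.ofReal_mul (by positivity),
    ← ENNReal.ofReal_mul (by positivity), ← ENNReal.ofReal_mul (by positivity)]
  congr 1
  unfold boxVol unitVol
  rw [mul_pow, mul_pow c, pow_add]
  ring

lemma box_subset_of_le {c R R' : ℝ} (hc : 0 ≤ c) (hR : 0 ≤ R) (hRR' : R ≤ R') (z : Space n₁ n₂) :
    box ϰ c z R ⊆ box ϰ c z R' := by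
  intro y hy
  rw [mem_box] at hy ⊢
  have hM : 0 ≤ max R ‖z.1‖ := le_max_of_le_left hR
  have hR' : 0 ≤ R' := hR.trans hRR'
  exact ⟨hy.1.trans (by gcongr), hy.2.trans (by gcongr)⟩

lemma max_norm_le {c R : ℝ} (hc : 0 ≤ c) (hR : 0 ≤ R) {u v : EuclideanSpace ℝ (Fin n₁)}
    (h : ‖u - v‖ ≤ c * R) : max R ‖u‖ ≤ (1 + c) * max R ‖v‖ := by
  have h1 := norm_sub_norm_le u v
  have h2 := le_max_left R ‖v‖
  have h3 := le_max_right R ‖v‖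
  have h4 : c * R ≤ c * max R ‖v‖ := by gcongr
  have h5 : 0 ≤ c * max R ‖v‖ := by positivity
  refine max_le ?_ ?_ <;> linarith

/-- Moving the centre by `c` box lengths changes `max(R, |z'|)` by a factor at most `1 + c`, whose
power `ϰ` enters the sides in `x''`. -/
lemma box_trans {c c' R : ℝ} (hc : 0 ≤ c) (hc' : 0 ≤ c') (hR : 0 < R) {x y z : Space n₁ n₂}
    (hy : y ∈ box ϰ c z R) (hx : x ∈ box ϰ c' y R) : x ∈ box ϰ (c + c' * (1 + c) ^ ϰ) z R := by
  rw [mem_box] at *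
  have hM : 0 < max R ‖z.1‖ := lt_max_of_lt_left hR
  have h1 : (1 : ℝ) ≤ (1 + c) ^ ϰ := one_le_pow₀ (by linarith)
  constructor
  · calc ‖x.1 - z.1‖ ≤ ‖x.1 - y.1‖ + ‖y.1 - z.1‖ := norm_sub_le_norm_sub_add_norm_sub _ _ _
      _ ≤ c' * 1 * R + c * R := by linarith [hx.1, hy.1]
      _ ≤ c' * (1 + c) ^ ϰ * R + c * R := by gcongr
      _ = _ := by ring
  · calc ‖x.2 - z.2‖ ≤ ‖x.2 - y.2‖ + ‖y.2 - z.2‖ := norm_sub_le_norm_sub_add_norm_sub _ _ _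
      _ ≤ c' * (R * max R ‖y.1‖ ^ ϰ) + c * (R * max R ‖z.1‖ ^ ϰ) := add_le_add hx.2 hy.2
      _ ≤ c' * (R * ((1 + c) * max R ‖z.1‖) ^ ϰ) + c * (R * max R ‖z.1‖ ^ ϰ) := by
        gcongr
        exact max_norm_le hc hR.le hy.1
      _ = _ := by rw [mul_pow]; ring

lemma boxVol_le {c R : ℝ} (hc : 0 ≤ c) (hR : 0 < R) {u v : EuclideanSpace ℝ (Fin n₁)}
    (h : ‖u - v‖ ≤ c * R) : boxVol n₂ ϰ u R ≤ ((1 + c) ^ ϰ) ^ n₂ * boxVol n₂ ϰ v R := by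
  have hM : 0 < max R ‖v‖ := lt_max_of_lt_left hR
  calc boxVol n₂ ϰ u R ≤ R ^ n₁ * (R * ((1 + c) * max R ‖v‖) ^ ϰ) ^ n₂ := by
        unfold boxVol
        gcongr
        exact max_norm_le hc hR.le h
    _ = _ := by unfold boxVol; simp only [mul_pow]; ring

lemma mem_box_of_grushinDist_lt {x y : Space n₁ n₂} {R : ℝ} (hR : 0 < R)
    (h : grushinDist ϰ x y < 2 * R) : x ∈ box ϰ (2 * 4 ^ ϰ) y R := by
  have h1 := (norm_fst_sub_le_grushinDist ϰ x y).trans_lt h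
  have h2 := norm_snd_sub_lt_of_grushinDist_lt (by positivity) h
  rw [mem_box]
  have h3 : (1 : ℝ) ≤ 4 ^ ϰ := one_le_pow₀ (by norm_num)
  refine ⟨h1.le.trans ?_, h2.le.trans ?_⟩
  · calc 2 * R = 2 * 1 * R := by ring
      _ ≤ 2 * 4 ^ ϰ * R := by gcongr
  -- `|x'| ≤ |y'| + 2R`, so the sum of the norms is at most `2|y'| + 2R`.
  · have h4 : max (‖x.1‖ + ‖y.1‖) (2 * R) ≤ 4 * max R ‖y.1‖ := by
      have h5 := norm_sub_norm_le x.1 y.1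
      have h6 := le_max_left R ‖y.1‖
      have h7 := le_max_right R ‖y.1‖
      refine max_le ?_ ?_ <;> linarith
    calc 2 * R * max (‖x.1‖ + ‖y.1‖) (2 * R) ^ ϰ ≤ 2 * R * (4 * max R ‖y.1‖) ^ ϰ := by gcongr
      _ = _ := by rw [mul_pow]; ring

lemma box_subset_grushinBall {x : Space n₁ n₂} {r : ℝ} (hr : 0 < r) :
    box ϰ (1 / (4 * 2 ^ ϰ)) x r ⊆ grushinBall ϰ x r := by
  intro y hy
  rw [mem_box] at hy
  have h3 : (1 : ℝ) ≤ 2 ^ ϰ := one_le_pow₀ (by norm_num)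
  have hM : 0 < max r ‖x.1‖ := lt_max_of_lt_left hr
  have key : grushinDist ϰ x y < 2 * (r / 2) := by
    refine grushinDist_lt (by positivity) ?_ ?_
    · rw [norm_sub_rev]
      refine hy.1.trans_lt ?_
      rw [div_mul_eq_mul_div, one_mul, div_lt_div_iff₀ (by positivity) (by positivity)]
      nlinarith
    · rw [norm_sub_rev]
      have h4 : max r ‖x.1‖ / 2 ≤ max (‖x.1‖ + ‖y.1‖) (r / 2) := by
        rw [div_le_iff₀ two_pos]
        have h5 := le_max_left (‖x.1‖ + ‖y.1‖) (r / 2)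
        have h6 := le_max_right (‖x.1‖ + ‖y.1‖) (r / 2)
        have := norm_nonneg x.1
        have := norm_nonneg y.1
        refine max_le ?_ ?_ <;> linarith
      calc ‖y.2 - x.2‖ ≤ 1 / (4 * 2 ^ ϰ) * (r * max r ‖x.1‖ ^ ϰ) := hy.2
        _ = r / 4 * (max r ‖x.1‖ / 2) ^ ϰ := by rw [div_pow]; field_simp
        _ < r / 2 * (max r ‖x.1‖ / 2) ^ ϰ := by gcongr; norm_num
        _ ≤ _ := by gcongr
  rw [mul_div_cancel₀ r two_ne_zero] at key
  exact key

lemma exists_le_ballVol (n₁ n₂ ϰ : ℕ) : ∃ c : ℝ, 0 < c ∧ ∀ (x : Space n₁ n₂) (r : ℝ), 0 < r →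
    c * boxVol n₂ ϰ x.1 r ≤ ballVol ϰ x r := by
  refine ⟨(1 / (4 * 2 ^ ϰ)) ^ (n₁ + n₂) * unitVol n₁ n₂,
    mul_pos (by positivity) (unitVol_pos _ _), fun x r hr => ?_⟩
  -- A set of infinite measure would have real volume `0`, so finiteness is needed for a lower
  -- bound.
  have hfin : volume (grushinBall ϰ x r) ≠ ⊤ := by
    refine measure_ne_top_of_subset (s := box ϰ (2 * 4 ^ ϰ) x r) (fun y hy => ?_) ?_
    · refine mem_box_of_grushinDist_lt hr ?_
      rw [grushinDist_comm]
      have : grushinDist ϰ x y < r := hy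
      linarith
    · rw [volume_box (by positivity) hr]
      exact ENNReal.ofReal_ne_top
  have h := measureReal_mono (μ := volume) (box_subset_grushinBall (ϰ := ϰ) (x := x) hr) hfin
  refine le_trans (le_of_eq ?_) h
  have h1 := boxVol_pos n₂ ϰ x.1 hr
  have h2 := unitVol_pos n₁ n₂
  rw [measureReal_def, volume_box (by positivity) hr, ENNReal.toReal_ofReal (by positivity)]
  ring

/-- The exponent is `Q`: shrinking from `R` to `r` costs `(r/R)^{n₁}` in `x'` and at most a constant
times `(r/R)^{(1+ϰ) n₂}` in `x''`. The factor `3` absorbs the shift from `v` to `u`. -/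
lemma boxVol_scale_le {r R : ℝ} (hr : 0 < r) (hrR : r ≤ R) {u v : EuclideanSpace ℝ (Fin n₁)}
    (h : ‖u - v‖ ≤ 2 * R) :
    (r / R) ^ (n₁ + (1 + ϰ) * n₂) * boxVol n₂ ϰ v R ≤ (3 ^ ϰ) ^ n₂ * boxVol n₂ ϰ u r := by
  have hR : 0 < R := hr.trans_le hrR
  have hM : 0 < max r ‖u‖ := lt_max_of_lt_left hr
  have hM' : 0 < max R ‖v‖ := lt_max_of_lt_left hR
  have key : r / R * max R ‖v‖ ≤ 3 * max r ‖u‖ := by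
    have h1 := norm_sub_norm_le v u
    rw [norm_sub_rev] at h1
    have h2 := le_max_left r ‖u‖
    have h3 := le_max_right r ‖u‖
    rw [div_mul_eq_mul_div, div_le_iff₀ hR]
    have h4 : r * ‖u‖ ≤ R * max r ‖u‖ := by gcongr
    have h5 : r * R ≤ R * max r ‖u‖ := by rw [mul_comm]; gcongr
    rcases max_cases R ‖v‖ with ⟨h6, _⟩ | ⟨h6, _⟩
    · rw [h6]; nlinarith
    · rw [h6]; nlinarith
  calc (r / R) ^ (n₁ + (1 + ϰ) * n₂) * boxVol n₂ ϰ v R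
      = r ^ n₁ * (r * (r / R * max R ‖v‖) ^ ϰ) ^ n₂ := by
        unfold boxVol
        rw [pow_add, pow_mul, pow_add, pow_one]
        simp only [mul_pow, div_pow]
        field_simp
    _ ≤ r ^ n₁ * (r * (3 * max r ‖u‖) ^ ϰ) ^ n₂ := by gcongr
    _ = _ := by unfold boxVol; simp only [mul_pow]; ring

/-- Box volumes depend only on the first variable, so both small balls have the same lower bound in
terms of the large box at `y`. Its two square roots multiply back to it. -/
lemma exists_le_ballVol_mul_ballVol (n₁ n₂ ϰ : ℕ) : ∃ c : ℝ, 0 < c ∧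
    ∀ (x y : Space n₁ n₂) (r R : ℝ), 0 < r → r ≤ R → ‖x.1 - y.1‖ ≤ 2 * R →
    c * ((r / R) ^ (n₁ + (1 + ϰ) * n₂) * boxVol n₂ ϰ y.1 R)
      ≤ ballVol ϰ x r ^ ((1 : ℝ) / 2) * ballVol ϰ y r ^ ((1 : ℝ) / 2) := by
  obtain ⟨c, hc, h⟩ := exists_le_ballVol n₁ n₂ ϰ
  refine ⟨c / (3 ^ ϰ) ^ n₂, by positivity, fun x y r R hr hrR hxy => ?_⟩
  have hR : 0 < R := hr.trans_le hrR
  have hv := boxVol_pos n₂ ϰ y.1 hR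
  have hb : ∀ u : Space n₁ n₂, ‖u.1 - y.1‖ ≤ 2 * R →
      c / (3 ^ ϰ) ^ n₂ * ((r / R) ^ (n₁ + (1 + ϰ) * n₂) * boxVol n₂ ϰ y.1 R) ≤ ballVol ϰ u r := by
    intro u hu
    refine le_trans ?_ (h u r hr)
    rw [div_mul_eq_mul_div, div_le_iff₀ (by positivity), mul_assoc]
    refine mul_le_mul_of_nonneg_left ?_ hc.le
    rw [mul_comm (boxVol n₂ ϰ u.1 r)]
    exact boxVol_scale_le hr hrR hu
  set W := c / (3 ^ ϰ) ^ n₂ * ((r / R) ^ (n₁ + (1 + ϰ) * n₂) * boxVol n₂ ϰ y.1 R) with hW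
  have hW0 : 0 ≤ W := by positivity
  have h1 := hb x hxy
  have h2 := hb y (by simp; positivity)
  calc W = W ^ ((1 : ℝ) / 2) * W ^ ((1 : ℝ) / 2) := by
        rw [← Real.sqrt_eq_rpow, Real.mul_self_sqrt hW0]
    _ ≤ _ := mul_le_mul (Real.rpow_le_rpow hW0 h1 (by norm_num))
        (Real.rpow_le_rpow hW0 h2 (by norm_num)) (by positivity)
        (Real.rpow_nonneg (hW0.trans h1) _)

/-- Polynomial decay of order `Q + 1/2`, in dyadic form. -/
lemma exists_dyadic_decay (n₁ n₂ ϰ : ℕ) : ∃ C : ℝ, 0 < C ∧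
    ∀ (x y : Space n₁ n₂) (r A a : ℝ), 0 < r → 0 ≤ a →
    ballVol ϰ x r ^ ((1 : ℝ) / 2) * ballVol ϰ y r ^ ((1 : ℝ) / 2) * a ≤ A →
    ballVol ϰ x r ^ ((1 : ℝ) / 2) * ballVol ϰ y r ^ ((1 : ℝ) / 2) *
      grushinDist ϰ x y ^ (homDim n₁ n₂ ϰ + 1 / 2) * a ≤ A * r ^ (homDim n₁ n₂ ϰ + 1 / 2) →
    ∃ i : ℕ, grushinDist ϰ x y < 2 * (2 ^ i * r) ∧
      a ≤ C * A * ((2 ^ i : ℝ) ^ (-(1 / 2) : ℝ) / boxVol n₂ ϰ y.1 (2 ^ i * r)) := by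
  obtain ⟨c, hc, h⟩ := exists_le_ballVol_mul_ballVol n₁ n₂ ϰ
  refine ⟨c⁻¹, by positivity, fun x y r A a hr ha hA hA' => ?_⟩
  have hd0 := grushinDist_nonneg ϰ x y
  have hd1 := norm_fst_sub_le_grushinDist ϰ x y
  rcases lt_or_ge (grushinDist ϰ x y) r with hd | hd
  · refine ⟨0, by rw [pow_zero, one_mul]; linarith, ?_⟩
    have hv := boxVol_pos n₂ ϰ y.1 hr
    have h1 := h x y r r hr le_rfl (by linarith)
    rw [div_self hr.ne', one_pow, one_mul] at h1
    rw [pow_zero, Real.one_rpow, one_mul, mul_one_div, inv_mul_eq_div, div_div,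
      le_div_iff₀ (by positivity), mul_comm]
    exact (by gcongr : _ ≤ _).trans hA
  -- `2^i r ≤ d < 2^{i+1} r`.
  · obtain ⟨i, hi1, hi2⟩ := exists_nat_pow_near ((one_le_div hr).2 hd) (one_lt_two)
    rw [le_div_iff₀ hr] at hi1
    rw [div_lt_iff₀ hr, pow_succ'] at hi2
    refine ⟨i, by linarith, ?_⟩
    have hp : (0 : ℝ) < 2 ^ i := by positivity
    have hR : 0 < 2 ^ i * r := by positivity
    have hrR : r ≤ 2 ^ i * r := le_mul_of_one_le_left hr.le (one_le_pow₀ one_le_two)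
    have hv := boxVol_pos n₂ ϰ y.1 hR
    set v := boxVol n₂ ϰ y.1 (2 ^ i * r)
    have h1 := h x y r (2 ^ i * r) hr hrR (by linarith)
    have h2 : r / (2 ^ i * r) = (2 ^ i : ℝ)⁻¹ := by field_simp
    rw [h2] at h1
    set s : ℝ := homDim n₁ n₂ ϰ + 1 / 2 with hs
    have hs0 : 0 ≤ s := by rw [hs, homDim]; positivity
    -- The volume loss `2^{-iQ}` against the decay `2^{i(Q+1/2)}` leaves the surplus `2^{i/2}`.
    have hpow : ((2 ^ i : ℝ)⁻¹) ^ (n₁ + (1 + ϰ) * n₂) * (2 ^ i : ℝ) ^ s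
        = (2 ^ i : ℝ) ^ ((1 / 2) : ℝ) := by
      rw [← Real.rpow_natCast, Real.inv_rpow hp.le, ← Real.rpow_neg hp.le, ← Real.rpow_add hp]
      congr 1
      rw [hs, homDim]
      push_cast
      ring
    have h3 : c * (((2 ^ i : ℝ)⁻¹) ^ (n₁ + (1 + ϰ) * n₂) * v) * ((2 ^ i) ^ s * r ^ s) * a
        ≤ A * r ^ s := by
      refine le_trans ?_ hA'
      rw [← Real.mul_rpow hp.le hr.le]
      have h5 : 0 ≤ c * (((2 ^ i : ℝ)⁻¹) ^ (n₁ + (1 + ϰ) * n₂) * v) := by positivity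
      exact mul_le_mul_of_nonneg_right (mul_le_mul h1 (Real.rpow_le_rpow hR.le hi1 hs0)
        (by positivity) (h5.trans h1)) ha
    have hrs : 0 < r ^ s := Real.rpow_pos_of_pos hr s
    have h4 : c * v * (2 ^ i : ℝ) ^ ((1 / 2) : ℝ) * a ≤ A := by
      rw [← hpow]
      refine le_of_mul_le_mul_right ?_ hrs
      linarith
    have hq : 0 < (2 ^ i : ℝ) ^ ((1 / 2) : ℝ) := Real.rpow_pos_of_pos hp _
    have : c⁻¹ * A * ((2 ^ i : ℝ) ^ (-(1 / 2) : ℝ) / v) = A / (c * v * (2 ^ i : ℝ) ^ ((1 / 2) : ℝ)) := by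
      rw [Real.rpow_neg hp.le]; field_simp
    rw [this, le_div_iff₀ (by positivity), mul_comm]
    exact h4

end Geometry

/-! ### Integrable majorants of the kernels -/

section Majorant

open scoped ENNReal

variable {n₁ n₂ : ℕ} {ϰ : ℕ}

/-- A sum of multiples of indicator functions of dyadic dilates of the box of size `r` around `z`,
its integral being bounded uniformly in `r` and `z`. -/
def majorant (ϰ : ℕ) (c r : ℝ) (z x : Space n₁ n₂) : ℝ≥0∞ :=
  ∑' i : ℕ, (box ϰ c z (2 ^ i * r)).indicator (fun _ =>
    ENNReal.ofReal ((2 ^ i : ℝ) ^ (-(1 / 4) : ℝ) / boxVol n₂ ϰ z.1 (2 ^ i * r))) x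

lemma measurable_majorant (ϰ : ℕ) (c r : ℝ) (z : Space n₁ n₂) : Measurable (majorant ϰ c r z) :=
  Measurable.tsum fun _ => measurable_const.indicator (measurableSet_box _ _ _ _)

lemma summable_dyadic_rpow : Summable fun i : ℕ => (2 ^ i : ℝ) ^ (-(1 / 4) : ℝ) := by
  have h : ∀ i : ℕ, (2 ^ i : ℝ) ^ (-(1 / 4) : ℝ) = ((2 : ℝ) ^ (-(1 / 4) : ℝ)) ^ i := fun i => by
    rw [← Real.rpow_natCast, ← Real.rpow_natCast, ← Real.rpow_mul two_pos.le,
      ← Real.rpow_mul two_pos.le, mul_comm]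
  simp_rw [h]
  exact summable_geometric_of_lt_one (by positivity)
    (Real.rpow_lt_one_of_one_lt_of_neg one_lt_two (by norm_num))

lemma exists_lintegral_majorant_le (n₁ n₂ ϰ : ℕ) {c : ℝ} (hc : 0 ≤ c) :
    ∃ C : ℝ, 0 < C ∧ ∀ (r : ℝ) (z : Space n₁ n₂), 0 < r →
      ∫⁻ x, majorant ϰ c r z x ≤ ENNReal.ofReal C := by
  have hs := summable_dyadic_rpow
  have hS : 0 ≤ ∑' i : ℕ, (2 ^ i : ℝ) ^ (-(1 / 4) : ℝ) := tsum_nonneg fun i => by positivity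
  have hu := unitVol_pos n₁ n₂
  -- Each term of the majorant integrates to a constant times `2^{-i/4}`. The `1` keeps the bound
  -- positive when `c = 0`.
  refine ⟨c ^ (n₁ + n₂) * unitVol n₁ n₂ * (∑' i : ℕ, (2 ^ i : ℝ) ^ (-(1 / 4) : ℝ)) + 1,
    by positivity, fun r z hr => ?_⟩
  unfold majorant
  rw [lintegral_tsum fun i =>
    (measurable_const.indicator (measurableSet_box _ _ _ _)).aemeasurable]
  have hterm : ∀ i : ℕ, ∫⁻ x, (box ϰ c z (2 ^ i * r)).indicator (fun _ =>
      ENNReal.ofReal ((2 ^ i : ℝ) ^ (-(1 / 4) : ℝ) / boxVol n₂ ϰ z.1 (2 ^ i * r))) x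
      = ENNReal.ofReal (c ^ (n₁ + n₂) * unitVol n₁ n₂ * (2 ^ i : ℝ) ^ (-(1 / 4) : ℝ)) := by
    intro i
    have hR : 0 < 2 ^ i * r := by positivity
    have hv := boxVol_pos n₂ ϰ z.1 hR
    rw [lintegral_indicator_const (measurableSet_box _ _ _ _), volume_box hc hR,
      ← ENNReal.ofReal_mul (by positivity)]
    congr 1
    field_simp
  simp_rw [hterm]
  rw [← ENNReal.ofReal_tsum_of_nonneg (fun i => by positivity) (hs.mul_left _), tsum_mul_left]
  exact ENNReal.ofReal_le_ofReal (by linarith)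

/-- If `y` is within `c` box lengths of `z` at scale `r`, the same holds at every larger scale `2^i
r`, so the boxes can be recentred term by term with one constant. -/
lemma majorant_le {c c' r : ℝ} (hc : 0 ≤ c) (hc' : 0 ≤ c') (hr : 0 < r) {y z : Space n₁ n₂}
    (hy : y ∈ box ϰ c z r) (x : Space n₁ n₂) :
    majorant ϰ c' r y x
      ≤ ENNReal.ofReal (((1 + c) ^ ϰ) ^ n₂) * majorant ϰ (c + c' * (1 + c) ^ ϰ) r z x := by
  unfold majorant
  rw [← ENNReal.tsum_mul_left]
  refine ENNReal.tsum_le_tsum fun i => ?_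
  have hR : 0 < 2 ^ i * r := by positivity
  have hrR : r ≤ 2 ^ i * r := le_mul_of_one_le_left hr.le (one_le_pow₀ one_le_two)
  have hy' : y ∈ box ϰ c z (2 ^ i * r) := box_subset_of_le hc hr.le hrR z hy
  by_cases hx : x ∈ box ϰ c' y (2 ^ i * r)
  · rw [Set.indicator_of_mem hx, Set.indicator_of_mem (box_trans hc hc' hR hy' hx),
      ← ENNReal.ofReal_mul (by positivity)]
    refine ENNReal.ofReal_le_ofReal ?_
    have h1 := boxVol_pos n₂ ϰ y.1 hR
    have h2 := boxVol_pos n₂ ϰ z.1 hR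
    have h3 : boxVol n₂ ϰ z.1 (2 ^ i * r) ≤ ((1 + c) ^ ϰ) ^ n₂ * boxVol n₂ ϰ y.1 (2 ^ i * r) := by
      refine boxVol_le hc hR ?_
      rw [norm_sub_rev]
      exact (mem_box.1 hy').1
    rw [mul_div_assoc', div_le_div_iff₀ h1 h2, mul_comm (((1 + c) ^ ϰ) ^ n₂), mul_assoc]
    gcongr
  · rw [Set.indicator_of_notMem hx]
    exact zero_le

/-- The bounds of `SupCondition` and `GradSupCondition` in terms of the majorant. -/
lemma exists_le_majorant {R₀ : ℝ} (hR₀ : homDim n₁ n₂ ϰ + 1 / 2 ≤ R₀)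
    {F : ℕ → Space n₁ n₂ → Space n₁ n₂ → ℝ} (hF : ∀ j x y, 0 ≤ F j x y) {A : ℝ}
    (h : ∀ r ∈ Set.Icc 0 R₀, ∀ (j : ℕ) (x y : Space n₁ n₂),
      ballVol ϰ x (2 ^ (-(j : ℝ) / 2)) ^ ((1 : ℝ) / 2) *
        ballVol ϰ y (2 ^ (-(j : ℝ) / 2)) ^ ((1 : ℝ) / 2) * grushinDist ϰ x y ^ r * F j x y
        ≤ A * 2 ^ (-(j : ℝ) * r / 2)) :
    ∃ C : ℝ, 0 < C ∧ ∀ (j : ℕ) (x y : Space n₁ n₂) (B : ℝ), 0 ≤ B →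
      (∀ i : ℕ, grushinDist ϰ x y < 2 * (2 ^ i * 2 ^ (-(j : ℝ) / 2)) →
        (2 ^ i : ℝ) ^ (-(1 / 4) : ℝ) ≤ B) →
      ENNReal.ofReal (F j x y)
        ≤ ENNReal.ofReal (C * B) * majorant ϰ (2 * 4 ^ ϰ) (2 ^ (-(j : ℝ) / 2)) y x := by
  obtain ⟨C, hC, hdec⟩ := exists_dyadic_decay n₁ n₂ ϰ
  have hQ : 0 ≤ homDim n₁ n₂ ϰ + 1 / 2 := by unfold homDim; positivity
  refine ⟨C * max A 1, by positivity, fun j x y B hB hBi => ?_⟩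
  set r : ℝ := 2 ^ (-(j : ℝ) / 2) with hr
  have hr0 : 0 < r := by positivity
  -- Only the orders `0` and `Q + 1/2` are used.
  have h1 := h 0 ⟨le_rfl, hQ.trans hR₀⟩ j x y
  have h2 := h _ ⟨hQ, hR₀⟩ j x y
  rw [Real.rpow_zero, mul_one, mul_zero, zero_div, Real.rpow_zero, mul_one] at h1
  rw [mul_div_right_comm, Real.rpow_mul two_pos.le, ← hr] at h2
  obtain ⟨i, hi1, hi2⟩ := hdec x y r (max A 1) (F j x y) hr0 (hF j x y)
    (h1.trans (le_max_left _ _)) (h2.trans (by gcongr; exact le_max_left _ _))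
  have hR : 0 < 2 ^ i * r := by positivity
  have hv := boxVol_pos n₂ ϰ y.1 hR
  -- One factor `2^{-i/4}` goes into the majorant, the other is bounded by `B`.
  have hq : (2 ^ i : ℝ) ^ (-(1 / 2) : ℝ) = (2 ^ i : ℝ) ^ (-(1 / 4) : ℝ) * (2 ^ i : ℝ) ^ (-(1 / 4) : ℝ) := by
    rw [← Real.rpow_add (by positivity)]; norm_num
  have h3 : F j x y ≤ C * max A 1 * B * ((2 ^ i : ℝ) ^ (-(1 / 4) : ℝ) / boxVol n₂ ϰ y.1 (2 ^ i * r)) := by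
    refine hi2.trans ?_
    rw [hq, mul_div_assoc, mul_assoc (C * max A 1)]
    gcongr
    exact hBi i hi1
  refine (ENNReal.ofReal_le_ofReal h3).trans ?_
  rw [ENNReal.ofReal_mul (by positivity)]
  gcongr
  refine le_trans (le_of_eq ?_) (ENNReal.le_tsum i)
  rw [Set.indicator_of_mem (mem_box_of_grushinDist_lt hR hi1)]

end Majorant

/-! ### Increments along the vector fields -/

section Increments

variable {n₁ n₂ : ℕ} {ϰ : ℕ}

lemma norm_partialFst_le_gradNorm (ϰ : ℕ) (f : Space n₁ n₂ → ℂ) (x : Space n₁ n₂) (i : Fin n₁) :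
    ‖partialFst i f x‖ ≤ gradNorm ϰ f x := by
  refine Real.le_sqrt_of_sq_le ?_
  have h := Finset.single_le_sum (f := fun i => ‖partialFst i f x‖ ^ 2)
    (fun i _ => sq_nonneg _) (Finset.mem_univ i)
  refine h.trans (le_add_of_nonneg_right ?_)
  exact Finset.sum_nonneg fun _ _ => Finset.sum_nonneg fun _ _ => sq_nonneg _

/-- The pure power, the multi-index `α = ϰ e_i`, is one of the fields. -/
lemma pow_mul_norm_partialSnd_le_gradNorm (f : Space n₁ n₂ → ℂ) (x : Space n₁ n₂) (i : Fin n₁)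
    (k : Fin n₂) : |x.1 i| ^ ϰ * ‖partialSnd k f x‖ ≤ gradNorm ϰ f x := by
  refine Real.le_sqrt_of_sq_le ?_
  have hmem : (Pi.single i ϰ : Fin n₁ → ℕ) ∈
      Finset.piAntidiag (Finset.univ : Finset (Fin n₁)) ϰ := by
    simp [Finset.mem_piAntidiag]
  have h0 : |x.1 i| ^ ϰ * ‖partialSnd k f x‖ = ‖fieldSnd (Pi.single i ϰ) k f x‖ := by
    rw [fieldSnd, norm_mul, Complex.norm_real, Finset.prod_eq_single i]
    · simp
    · intro l _ hl
      simp [Pi.single_eq_of_ne hl]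
    · simp
  rw [h0]
  have h1 := Finset.single_le_sum (f := fun k => ‖fieldSnd (Pi.single i ϰ) k f x‖ ^ 2)
    (fun i _ => sq_nonneg _) (Finset.mem_univ k)
  have h2 := Finset.single_le_sum (f := fun α => ∑ k, ‖fieldSnd α k f x‖ ^ 2)
    (fun i _ => Finset.sum_nonneg fun _ _ => sq_nonneg _) hmem
  refine (h1.trans h2).trans (le_add_of_nonneg_left ?_)
  exact Finset.sum_nonneg fun _ _ => sq_nonneg _

lemma gradNorm_nonneg (ϰ : ℕ) (f : Space n₁ n₂ → ℂ) (x : Space n₁ n₂) : 0 ≤ gradNorm ϰ f x :=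
  Real.sqrt_nonneg _

lemma norm_apply_le_of_forall_single {n : ℕ} (L : EuclideanSpace ℝ (Fin n) →L[ℝ] ℂ) {G : ℝ}
    (hL : ∀ i, ‖L (EuclideanSpace.single i 1)‖ ≤ G) (v : EuclideanSpace ℝ (Fin n)) :
    ‖L v‖ ≤ n * ‖v‖ * G := by
  have hv : v = ∑ i, v i • EuclideanSpace.single i (1 : ℝ) := by
    conv_lhs => rw [← (EuclideanSpace.basisFun (Fin n) ℝ).sum_repr v]
    simp
  calc ‖L v‖ = ‖∑ i, v i • L (EuclideanSpace.single i 1)‖ := by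
        conv_lhs => rw [hv]
        simp only [map_sum, map_smul]
    _ ≤ ∑ i, ‖v i • L (EuclideanSpace.single i 1)‖ := norm_sum_le _ _
    _ ≤ ∑ _i : Fin n, ‖v‖ * G := by
        refine Finset.sum_le_sum fun i _ => ?_
        rw [norm_smul, Real.norm_eq_abs]
        exact mul_le_mul (abs_apply_le_norm v i) (hL i) (norm_nonneg _) (norm_nonneg _)
    _ = n * ‖v‖ * G := by simp [mul_assoc]

lemma norm_sub_le_of_norm_fderiv_segment_le {f : Space n₁ n₂ → ℂ} (hf : Differentiable ℝ f)
    {p q : Space n₁ n₂} {M : ℝ}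
    (h : ∀ w ∈ segment ℝ p q, ‖fderiv ℝ f w (q - p)‖ ≤ M) : ‖f q - f p‖ ≤ M := by
  have hd : ∀ t : ℝ, HasDerivAt (fun t : ℝ => f (p + t • (q - p)))
      (fderiv ℝ f (p + t • (q - p)) (q - p)) t := by
    intro t
    have h1 : HasDerivAt (fun t : ℝ => p + t • (q - p)) (q - p) t := by
      simpa using ((hasDerivAt_id t).smul_const (q - p)).const_add p
    exact (hf _).hasFDerivAt.comp_hasDerivAt t h1
  have := norm_image_sub_le_of_norm_deriv_le_segment_01'
    (f := fun t : ℝ => f (p + t • (q - p))) (C := M)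
    (fun t _ => (hd t).hasDerivWithinAt) (fun t ht => h _ ?_)
  · simpa using this
  · rw [segment_eq_image']
    exact ⟨t, ⟨ht.1, ht.2.le⟩, rfl⟩

/-- The increment of `f` between two points of a convex set, passing through a point where the
coordinate `z'_i` is not small. -/
lemma norm_sub_le_of_gradNorm_le {f : Space n₁ n₂ → ℂ} (hf : Differentiable ℝ f)
    {S : Set (Space n₁ n₂)} (hS : Convex ℝ S) {G : ℝ} (hG : ∀ w ∈ S, gradNorm ϰ f w ≤ G)
    {y z : Space n₁ n₂} (hy : y ∈ S) (hz : z ∈ S) (hyz : (z.1, y.2) ∈ S) (i : Fin n₁)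
    (hi : z.1 i ≠ 0) :
    ‖f y - f z‖ ≤ (n₁ * ‖y.1 - z.1‖ + n₂ * ‖y.2 - z.2‖ / |z.1 i| ^ ϰ) * G := by
  have hi' : 0 < |z.1 i| ^ ϰ := pow_pos (abs_pos.2 hi) _
  have h1 : ‖f y - f (z.1, y.2)‖ ≤ n₁ * ‖y.1 - z.1‖ * G := by
    refine norm_sub_le_of_norm_fderiv_segment_le hf fun w hw => ?_
    have hwS := hS.segment_subset hyz hy hw
    have h := norm_apply_le_of_forall_single
      ((fderiv ℝ f w).comp (ContinuousLinearMap.inl ℝ _ _)) (G := G)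
      (fun i => (norm_partialFst_le_gradNorm ϰ f w i).trans (hG w hwS)) (y.1 - z.1)
    have e : y - (z.1, y.2) = (y.1 - z.1, 0) := by ext <;> simp
    rw [e]
    exact h
  have h2 : ‖f (z.1, y.2) - f z‖ ≤ n₂ * ‖y.2 - z.2‖ / |z.1 i| ^ ϰ * G := by
    refine norm_sub_le_of_norm_fderiv_segment_le hf fun w hw => ?_
    have hwS := hS.segment_subset hz hyz hw
    have hw1 : w.1 = z.1 := by
      rw [segment_eq_image'] at hw
      obtain ⟨t, _, rfl⟩ := hw
      simp
    have h := norm_apply_le_of_forall_single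
      ((fderiv ℝ f w).comp (ContinuousLinearMap.inr ℝ _ _)) (G := G / |z.1 i| ^ ϰ)
      (fun k => by
        rw [le_div_iff₀ hi', mul_comm, ← hw1]
        exact (pow_mul_norm_partialSnd_le_gradNorm f w i k).trans (hG w hwS)) (y.2 - z.2)
    have e : (z.1, y.2) - z = (0, y.2 - z.2) := by ext <;> simp
    rw [e]
    refine le_trans h (le_of_eq ?_)
    ring
  calc ‖f y - f z‖ ≤ ‖f y - f (z.1, y.2)‖ + ‖f (z.1, y.2) - f z‖ :=
        norm_sub_le_norm_sub_add_norm_sub _ _ _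
    _ ≤ _ := by rw [add_mul]; exact add_le_add h1 h2

end Increments

/-! ### Kernel estimates on dyadic cubes -/

section CubeEstimates

open scoped ENNReal

variable {n₁ n₂ : ℕ} {ϰ : ℕ}

/-- A reference point for the dyadic cube of scale `2^{-k}` containing `x`. -/
def cubePoint (k : ℤ) (x : Space n₁ n₂) : Space n₁ n₂ := (cubeCentre k x.1, x.2)

lemma norm_snd_sub_le_cubeCentre {k : ℤ} {x : Space n₁ n₂} {i : Fin n₁}
    (hi : dyadicRho k x.1 ≤ 2 * |cubeCentre k x.1 i|) {y : Space n₁ n₂} (hy : y ∈ cube ϰ k x) :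
    ‖y.2 - x.2‖ ≤ n₂ * 2 ^ ϰ * (2 ^ (-k) * |cubeCentre k x.1 i| ^ ϰ) := by
  have h0 := dyadicRho_pos k x.1
  calc ‖y.2 - x.2‖ ≤ n₂ * (2 ^ (-k) * dyadicRho k x.1 ^ ϰ) := norm_snd_sub_le hy
    _ ≤ n₂ * (2 ^ (-k) * (2 * |cubeCentre k x.1 i|) ^ ϰ) := by gcongr
    _ = _ := by rw [mul_pow]; ring

/-- A free first component covers both the points of the cube and the corner `(z', y'')` of the
two-leg path joining `y` to the reference point. -/
lemma prod_mem_box_cubePoint (hn₁ : 1 ≤ n₁) {k : ℤ} {x y : Space n₁ n₂} (hy : y ∈ cube ϰ k x)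
    {u : EuclideanSpace ℝ (Fin n₁)} (hu : ‖u - cubeCentre k x.1‖ ≤ n₁ * 2 ^ (-k)) :
    (u, y.2) ∈ box ϰ (n₁ + n₂ * 2 ^ ϰ) (cubePoint k x) (2 ^ (-k)) := by
  obtain ⟨i, hi⟩ := exists_dyadicRho_le hn₁ k x.1
  rw [mem_box]
  have hl : (0 : ℝ) < 2 ^ (-k) := by positivity
  have hM : 0 < max (2 ^ (-k)) ‖cubeCentre k x.1‖ := lt_max_of_lt_left hl
  constructor
  · refine hu.trans ?_
    gcongr
    exact le_add_of_nonneg_right (by positivity)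
  · calc ‖y.2 - x.2‖ ≤ n₂ * 2 ^ ϰ * (2 ^ (-k) * |cubeCentre k x.1 i| ^ ϰ) :=
          norm_snd_sub_le_cubeCentre hi hy
      _ ≤ (n₁ + n₂ * 2 ^ ϰ) * (2 ^ (-k) * max (2 ^ (-k)) ‖cubeCentre k x.1‖ ^ ϰ) := by
        gcongr
        · exact le_add_of_nonneg_left (by positivity)
        · exact (abs_apply_le_norm _ _).trans (le_max_right _ _)

lemma mem_box_cubePoint (hn₁ : 1 ≤ n₁) {k : ℤ} {x y : Space n₁ n₂} (hy : y ∈ cube ϰ k x) :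
    y ∈ box ϰ (n₁ + n₂ * 2 ^ ϰ) (cubePoint k x) (2 ^ (-k)) :=
  prod_mem_box_cubePoint hn₁ hy (norm_fst_sub_cubeCentre_le hy)

lemma boxVol_cubePoint_le (hn₁ : 1 ≤ n₁) (k : ℤ) (x : Space n₁ n₂) :
    boxVol n₂ ϰ (cubePoint k x).1 (2 ^ (-k)) ≤ ((n₁ : ℝ) ^ ϰ) ^ n₂ * cubeVol n₂ ϰ k x.1 := by
  have hl : (0 : ℝ) < 2 ^ (-k) := by positivity
  have h0 := dyadicRho_pos k x.1
  have hn : (1 : ℝ) ≤ n₁ := by exact_mod_cast hn₁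
  have h1 : max (2 ^ (-k)) ‖cubeCentre k x.1‖ ≤ n₁ * dyadicRho k x.1 :=
    max_le ((two_zpow_neg_le_dyadicRho k x.1).trans (le_mul_of_one_le_left h0.le hn))
      (norm_cubeCentre_le k x.1)
  have hM : 0 < max (2 ^ (-k)) ‖cubeCentre k x.1‖ := lt_max_of_lt_left hl
  calc boxVol n₂ ϰ (cubePoint k x).1 (2 ^ (-k))
      ≤ (2 ^ (-k)) ^ n₁ * (2 ^ (-k) * (n₁ * dyadicRho k x.1) ^ ϰ) ^ n₂ := by
        unfold boxVol cubePoint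
        gcongr
    _ = _ := by unfold cubeVol; simp only [mul_pow]; ring

/-- The dilated cubes. -/
def star (ϰ : ℕ) (k : ℤ) (x : Space n₁ n₂) : Set (Space n₁ n₂) :=
  box ϰ ((n₁ + n₂ * 2 ^ ϰ) + 2 * 4 ^ ϰ * (1 + (n₁ + n₂ * 2 ^ ϰ)) ^ ϰ) (cubePoint k x) (2 ^ (-k))

lemma exists_volume_star_le (hn₁ : 1 ≤ n₁) (n₂ ϰ : ℕ) : ∃ C : ℝ, 0 < C ∧
    ∀ (k : ℤ) (x : Space n₁ n₂), volume (star ϰ k x) ≤ ENNReal.ofReal C * volume (cube ϰ k x) := by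
  have hu := unitVol_pos n₁ n₂
  have hn : (0 : ℝ) < n₁ := by exact_mod_cast hn₁
  refine ⟨(((n₁ + n₂ * 2 ^ ϰ) + 2 * 4 ^ ϰ * (1 + (n₁ + n₂ * 2 ^ ϰ)) ^ ϰ) ^ (n₁ + n₂) *
    ((n₁ : ℝ) ^ ϰ) ^ n₂) * unitVol n₁ n₂, by positivity, fun k x => ?_⟩
  rw [star, volume_box (by positivity) (by positivity), volume_cube,
    ← ENNReal.ofReal_mul (by positivity)]
  refine ENNReal.ofReal_le_ofReal ?_
  refine (mul_le_mul_of_nonneg_right (mul_le_mul_of_nonneg_left (boxVol_cubePoint_le hn₁ k x)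
    (by positivity)) hu.le).trans (le_of_eq ?_)
  ring

/-- The dilation factor of `star` is the constant of `box_trans` for the box containing the cube
followed by the box containing a ball of radius `2 * 2^(-k)`. -/
lemma le_grushinDist_of_notMem_star (hn₁ : 1 ≤ n₁) {k : ℤ} {x₀ x y : Space n₁ n₂}
    (hy : y ∈ cube ϰ k x₀) (hx : x ∉ star ϰ k x₀) : 2 * 2 ^ (-k) ≤ grushinDist ϰ x y := by
  by_contra hlt
  exact hx (box_trans (by positivity) (by positivity) (by positivity) (mem_box_cubePoint hn₁ hy)
    (mem_box_of_grushinDist_lt (by positivity) (not_le.1 hlt)))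

lemma two_pow_rpow_le_one (i : ℕ) : (2 ^ i : ℝ) ^ (-(1 / 4) : ℝ) ≤ 1 :=
  Real.rpow_le_one_of_one_le_of_nonpos (one_le_pow₀ one_le_two) (by norm_num)

/-- Smallness of the kernels away from the dilated cube. -/
lemma exists_enorm_le_of_notMem_star (hn₁ : 1 ≤ n₁) {R₀ : ℝ}
    (hR₀ : homDim n₁ n₂ ϰ + 1 / 2 ≤ R₀) {K : ℕ → Space n₁ n₂ → Space n₁ n₂ → ℂ}
    (hsup : SupCondition ϰ R₀ K) : ∃ C : ℝ, 0 < C ∧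
    ∀ (j : ℕ) (k : ℤ) (x₀ x y : Space n₁ n₂), y ∈ cube ϰ k x₀ → x ∉ star ϰ k x₀ →
      ‖K j x y‖ₑ ≤ ENNReal.ofReal (C * 2 ^ (-((j : ℝ) - 2 * k) / 8)) *
        majorant ϰ (2 * 4 ^ ϰ) (2 ^ (-(j : ℝ) / 2)) y x := by
  obtain ⟨A, hA⟩ := hsup
  obtain ⟨C, hC, h⟩ := exists_le_majorant hR₀ (F := fun j x y => ‖K j x y‖)
    (fun _ _ _ => norm_nonneg _) hA
  refine ⟨C, hC, fun j k x₀ x y hy hx => ?_⟩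
  have hd := le_grushinDist_of_notMem_star hn₁ hy hx
  have := h j x y (2 ^ (-((j : ℝ) - 2 * k) / 8)) (by positivity) fun i hi => ?_
  · rwa [ofReal_norm] at this
  -- Off the dilated cube only `2^i ≥ 2^{j/2 - k}` occur; the power `-1/4` of this is the stated
  -- gain.
  · have h1 : (2 : ℝ) ^ (-k : ℤ) ≤ 2 ^ i * 2 ^ (-(j : ℝ) / 2) := by linarith
    rw [← Real.rpow_intCast, ← Real.rpow_natCast, ← Real.rpow_add two_pos,
      Real.rpow_le_rpow_left_iff one_lt_two] at h1
    rw [← Real.rpow_natCast, ← Real.rpow_mul two_pos.le, Real.rpow_le_rpow_left_iff one_lt_two]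
    push_cast at h1
    linarith

/-- Smoothness of the kernels on the cube. -/
lemma exists_enorm_sub_le (hn₁ : 1 ≤ n₁) {R₀ : ℝ}
    (hR₀ : homDim n₁ n₂ ϰ + 1 / 2 ≤ R₀) {K : ℕ → Space n₁ n₂ → Space n₁ n₂ → ℂ}
    (hgrad : GradSupCondition ϰ R₀ K) : ∃ C c : ℝ, 0 < C ∧ 0 ≤ c ∧
    ∀ (j : ℕ) (k : ℤ) (x₀ x y : Space n₁ n₂), y ∈ cube ϰ k x₀ →
      (2 : ℝ) ^ (-k) ≤ 2 ^ (-(j : ℝ) / 2) →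
      ‖K j x y - K j x (cubePoint k x₀)‖ₑ
        ≤ ENNReal.ofReal (C * (2 ^ (-k) / 2 ^ (-(j : ℝ) / 2))) *
          majorant ϰ c (2 ^ (-(j : ℝ) / 2)) (cubePoint k x₀) x := by
  obtain ⟨hdiff, A, hA⟩ := hgrad
  -- The factor `2^{-j/2}` cancels the loss `2^{j/2}` in the gradient bound.
  obtain ⟨C, hC, h⟩ := exists_le_majorant hR₀
    (F := fun j x y => 2 ^ (-(j : ℝ) / 2) * gradNorm ϰ (K j x) y) (A := A)
    (fun _ _ _ => mul_nonneg (by positivity) (gradNorm_nonneg _ _ _)) (by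
      intro r hr j x y
      have h1 := mul_le_mul_of_nonneg_right (hA r hr j x y)
        (by positivity : (0 : ℝ) ≤ 2 ^ (-(j : ℝ) / 2))
      have h2 : (2 : ℝ) ^ ((j : ℝ) / 2) * 2 ^ (-(j : ℝ) / 2) = 1 := by
        rw [← Real.rpow_add two_pos, neg_div, add_neg_cancel, Real.rpow_zero]
      refine le_trans (le_of_eq ?_) (h1.trans (le_of_eq ?_))
      · ring
      · rw [mul_assoc A, mul_assoc ((2 : ℝ) ^ (-(j : ℝ) * r / 2)), h2, mul_one])
  set c₂ : ℝ := n₁ + n₂ * 2 ^ ϰ with hc₂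
  have hc₂0 : 0 ≤ c₂ := by positivity
  set c₃ : ℝ := ((1 + c₂) ^ ϰ) ^ n₂ with hc₃
  set c : ℝ := c₂ + 2 * 4 ^ ϰ * (1 + c₂) ^ ϰ with hc
  have hn : (0 : ℝ) < n₁ := by exact_mod_cast hn₁
  refine ⟨(n₁ * n₁ + n₂ * (n₂ * 2 ^ ϰ)) * (C * c₃), c, by positivity, by positivity,
    fun j k x₀ x y hy hkj => ?_⟩
  set r : ℝ := 2 ^ (-(j : ℝ) / 2) with hr
  have hr0 : 0 < r := by positivity
  set z := cubePoint k x₀ with hz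
  set l : ℝ := 2 ^ (-k) with hl
  have hl0 : 0 < l := by positivity
  -- Where the majorant is infinite there is nothing to prove; elsewhere the estimate is carried out
  -- in the reals.
  rcases eq_or_ne (majorant ϰ c r z x) ⊤ with htop | htop
  · rw [htop, ENNReal.mul_top]
    · exact le_top
    · simp only [ne_eq, ENNReal.ofReal_eq_zero, not_le]
      positivity
  set M := (majorant ϰ c r z x).toReal with hM
  have hM0 : 0 ≤ M := ENNReal.toReal_nonneg
  -- Since `l ≤ r`, recentring at `z` gives one gradient bound for the whole convex box.
  have hG : ∀ w ∈ box ϰ c₂ z l, gradNorm ϰ (K j x) w ≤ C * c₃ * M / r := by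
    intro w hw
    have h1 := h j x w 1 zero_le_one fun i _ => two_pow_rpow_le_one i
    have h2 := majorant_le hc₂0 (by positivity : (0 : ℝ) ≤ 2 * 4 ^ ϰ) hr0
      (box_subset_of_le hc₂0 hl0.le hkj z hw) x
    have h3 : ENNReal.ofReal (r * gradNorm ϰ (K j x) w) ≤ ENNReal.ofReal (C * c₃ * M) := by
      rw [ENNReal.ofReal_mul (p := C * c₃) (by positivity), ENNReal.ofReal_mul hC.le, hM,
        ENNReal.ofReal_toReal htop, mul_assoc]
      rw [mul_one] at h1
      exact h1.trans (by gcongr)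
    rw [ENNReal.ofReal_le_ofReal_iff (by positivity)] at h3
    rw [le_div_iff₀ hr0, mul_comm]
    exact h3
  obtain ⟨i, hi⟩ := exists_dyadicRho_le hn₁ k x₀.1
  have hρ := dyadicRho_pos k x₀.1
  have hzi : 0 < |cubeCentre k x₀.1 i| := by linarith
  have hfst := norm_fst_sub_cubeCentre_le hy
  have hsnd := norm_snd_sub_le_cubeCentre hi hy
  have hcen : ‖cubeCentre k x₀.1 - cubeCentre k x₀.1‖ ≤ n₁ * 2 ^ (-k) := by
    rw [sub_self, norm_zero]; positivity
  have hz1 : z ∈ box ϰ c₂ z l := prod_mem_box_cubePoint hn₁ (mem_cube_self ϰ k x₀) hcen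
  have hz2 : (z.1, y.2) ∈ box ϰ c₂ z l := prod_mem_box_cubePoint hn₁ hy hcen
  have hincr := norm_sub_le_of_gradNorm_le (hdiff j x) (convex_box ϰ c₂ z l) hG
    (mem_box_cubePoint hn₁ hy) hz1 hz2 i (abs_pos.1 hzi)
  have hsnd' : n₂ * ‖y.2 - z.2‖ / |z.1 i| ^ ϰ ≤ n₂ * (n₂ * 2 ^ ϰ) * l := by
    change n₂ * ‖y.2 - x₀.2‖ / |cubeCentre k x₀.1 i| ^ ϰ ≤ _
    rw [div_le_iff₀ (pow_pos hzi _), mul_assoc (n₂ : ℝ), mul_assoc (n₂ : ℝ)]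
    refine mul_le_mul_of_nonneg_left (hsnd.trans (le_of_eq ?_)) (by positivity)
    ring
  have hfin : ‖K j x y - K j x z‖
      ≤ (n₁ * n₁ + n₂ * (n₂ * 2 ^ ϰ)) * (C * c₃) * (l / r) * M := by
    calc _ ≤ (n₁ * ‖y.1 - z.1‖ + n₂ * ‖y.2 - z.2‖ / |z.1 i| ^ ϰ) * (C * c₃ * M / r) := hincr
      _ ≤ (n₁ * (n₁ * l) + n₂ * (n₂ * 2 ^ ϰ) * l) * (C * c₃ * M / r) := by
        gcongr
        exact hfst
      _ = _ := by ring
  rw [← ofReal_norm]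
  refine (ENNReal.ofReal_le_ofReal hfin).trans (le_of_eq ?_)
  rw [ENNReal.ofReal_mul (by positivity), hM, ENNReal.ofReal_toReal htop]

/-- The integral over the complement of the dilated cube of the `j`-th operator applied to a
function of mean zero on the cube. -/
lemma exists_lintegral_compl_star_le (hn₁ : 1 ≤ n₁) {R₀ : ℝ}
    (hR₀ : homDim n₁ n₂ ϰ + 1 / 2 ≤ R₀) {K : ℕ → Space n₁ n₂ → Space n₁ n₂ → ℂ}
    (hmeas : ∀ j, AEStronglyMeasurable (Function.uncurry (K j)) (volume.prod volume))
    (hsup : SupCondition ϰ R₀ K) (hgrad : GradSupCondition ϰ R₀ K) : ∃ C : ℝ, 0 < C ∧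
    ∀ (j : ℕ) (k : ℤ) (x₀ : Space n₁ n₂) (b : Space n₁ n₂ → ℂ),
      IntegrableOn b (cube ϰ k x₀) volume → ∫ y in cube ϰ k x₀, b y = 0 →
      ∫⁻ x in (star ϰ k x₀)ᶜ, ‖∫ y in cube ϰ k x₀, K j x y * b y‖ₑ
        ≤ ENNReal.ofReal (C * 2 ^ (-|(j : ℝ) - 2 * k| / 8)) * ∫⁻ y in cube ϰ k x₀, ‖b y‖ₑ := by
  obtain ⟨C₁, hC₁, h₁⟩ := exists_enorm_le_of_notMem_star hn₁ hR₀ hsup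
  obtain ⟨C₂, c, hC₂, hc, h₂⟩ := exists_enorm_sub_le hn₁ hR₀ hgrad
  obtain ⟨M₁, hM₁, hm₁⟩ := exists_lintegral_majorant_le n₁ n₂ ϰ (c := 2 * 4 ^ ϰ) (by positivity)
  obtain ⟨M₂, hM₂, hm₂⟩ := exists_lintegral_majorant_le n₁ n₂ ϰ hc
  refine ⟨C₁ * M₁ + C₂ * M₂, by positivity, fun j k x₀ b hb hb0 => ?_⟩
  have hQm := measurableSet_cube ϰ k x₀
  have hSm : MeasurableSet (star ϰ k x₀)ᶜ := (measurableSet_box _ _ _ _).compl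
  have hr0 : (0 : ℝ) < 2 ^ (-(j : ℝ) / 2) := by positivity
  -- For a cube of size at least `2^{-j/2}`, the size bound and Tonelli suffice and the mean of `b`
  -- is irrelevant. For a smaller cube, the mean zero is used and the bound holds on the whole
  -- space.
  rcases le_total (2 * (k : ℝ)) j with hjk | hjk
  · rw [abs_of_nonneg (by linarith)]
    set ε : ℝ := 2 ^ (-((j : ℝ) - 2 * k) / 8) with hε
    have hmeas2 : AEMeasurable (Function.uncurry fun x y => ‖K j x y‖ₑ * ‖b y‖ₑ)
        ((volume.restrict (star ϰ k x₀)ᶜ).prod (volume.restrict (cube ϰ k x₀))) := by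
      have h1 : AEMeasurable (fun p : Space n₁ n₂ × Space n₁ n₂ => ‖K j p.1 p.2‖ₑ)
          ((volume.restrict (star ϰ k x₀)ᶜ).prod (volume.restrict (cube ϰ k x₀))) := by
        rw [Measure.prod_restrict]
        exact (hmeas j).enorm.restrict
      exact h1.mul hb.1.enorm.comp_snd
    calc ∫⁻ x in (star ϰ k x₀)ᶜ, ‖∫ y in cube ϰ k x₀, K j x y * b y‖ₑ
        ≤ ∫⁻ x in (star ϰ k x₀)ᶜ, ∫⁻ y in cube ϰ k x₀, ‖K j x y‖ₑ * ‖b y‖ₑ := by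
          refine lintegral_mono fun x => (enorm_integral_le_lintegral_enorm _).trans (le_of_eq ?_)
          simp only [enorm_mul]
      _ = ∫⁻ y in cube ϰ k x₀, ∫⁻ x in (star ϰ k x₀)ᶜ, ‖K j x y‖ₑ * ‖b y‖ₑ :=
          lintegral_lintegral_swap hmeas2
      _ ≤ ∫⁻ y in cube ϰ k x₀, ENNReal.ofReal (C₁ * ε) * ENNReal.ofReal M₁ * ‖b y‖ₑ := by
          refine setLIntegral_mono_ae' hQm (Filter.Eventually.of_forall fun y hy => ?_)
          rw [lintegral_mul_const' _ _ enorm_ne_top]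
          gcongr
          calc ∫⁻ x in (star ϰ k x₀)ᶜ, ‖K j x y‖ₑ
              ≤ ∫⁻ x in (star ϰ k x₀)ᶜ, ENNReal.ofReal (C₁ * ε) *
                  majorant ϰ (2 * 4 ^ ϰ) (2 ^ (-(j : ℝ) / 2)) y x :=
                setLIntegral_mono_ae' hSm (Filter.Eventually.of_forall fun x hx =>
                  h₁ j k x₀ x y hy hx)
            _ ≤ ∫⁻ x, ENNReal.ofReal (C₁ * ε) *
                  majorant ϰ (2 * 4 ^ ϰ) (2 ^ (-(j : ℝ) / 2)) y x := setLIntegral_le_lintegral _ _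
            _ ≤ _ := by
              rw [lintegral_const_mul _ (measurable_majorant _ _ _ _)]
              gcongr
              exact hm₁ _ _ hr0
      _ = ENNReal.ofReal (C₁ * ε) * ENNReal.ofReal M₁ * ∫⁻ y in cube ϰ k x₀, ‖b y‖ₑ :=
          lintegral_const_mul'' _ hb.1.enorm
      _ ≤ _ := by
          rw [← ENNReal.ofReal_mul (by positivity)]
          refine mul_le_mul_left (ENNReal.ofReal_le_ofReal ?_) _
          nlinarith [mul_pos (mul_pos hC₂ hM₂) (by positivity : 0 < ε)]
  · have hkj : (2 : ℝ) ^ (-k : ℤ) ≤ 2 ^ (-(j : ℝ) / 2) := by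
      rw [← Real.rpow_intCast, Real.rpow_le_rpow_left_iff one_lt_two]
      push_cast
      linarith
    rw [abs_of_nonpos (by linarith)]
    set ε : ℝ := 2 ^ (- -((j : ℝ) - 2 * k) / 8) with hε
    have hlr : (2 : ℝ) ^ (-k : ℤ) / 2 ^ (-(j : ℝ) / 2) ≤ ε := by
      rw [← Real.rpow_intCast, ← Real.rpow_sub two_pos, hε, Real.rpow_le_rpow_left_iff one_lt_two]
      push_cast
      linarith
    set z := cubePoint k x₀
    set r : ℝ := 2 ^ (-(j : ℝ) / 2) with hr
    have hpt : ∀ x, ‖∫ y in cube ϰ k x₀, K j x y * b y‖ₑ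
        ≤ (ENNReal.ofReal (C₂ * ε) * majorant ϰ c r z x) * ∫⁻ y in cube ϰ k x₀, ‖b y‖ₑ := by
      intro x
      by_cases hint : IntegrableOn (fun y => K j x y * b y) (cube ϰ k x₀) volume
      · have heq : ∫ y in cube ϰ k x₀, K j x y * b y
            = ∫ y in cube ϰ k x₀, (K j x y - K j x z) * b y := by
          simp_rw [sub_mul]
          rw [integral_sub hint (hb.const_mul _), integral_const_mul, hb0, mul_zero, sub_zero]
        rw [heq]
        refine (enorm_integral_le_lintegral_enorm _).trans ?_
        rw [← lintegral_const_mul'' _ hb.1.enorm]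
        refine setLIntegral_mono_ae' hQm (Filter.Eventually.of_forall fun y hy => ?_)
        rw [enorm_mul]
        gcongr
        refine (h₂ j k x₀ x y hy hkj).trans ?_
        gcongr
      -- A non-integrable product has integral `0` by convention, so the bound is trivial.
      · rw [integral_undef hint, enorm_zero]
        exact zero_le
    calc ∫⁻ x in (star ϰ k x₀)ᶜ, ‖∫ y in cube ϰ k x₀, K j x y * b y‖ₑ
        ≤ ∫⁻ x, ‖∫ y in cube ϰ k x₀, K j x y * b y‖ₑ := setLIntegral_le_lintegral _ _
      _ ≤ ∫⁻ x, (ENNReal.ofReal (C₂ * ε) * majorant ϰ c r z x) *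
            ∫⁻ y in cube ϰ k x₀, ‖b y‖ₑ := lintegral_mono hpt
      _ = ENNReal.ofReal (C₂ * ε) * (∫⁻ x, majorant ϰ c r z x) *
            ∫⁻ y in cube ϰ k x₀, ‖b y‖ₑ := by
          rw [lintegral_mul_const _ ((measurable_majorant _ _ _ _).const_mul _),
            lintegral_const_mul _ (measurable_majorant _ _ _ _)]
      _ ≤ ENNReal.ofReal (C₂ * ε) * ENNReal.ofReal M₂ * ∫⁻ y in cube ϰ k x₀, ‖b y‖ₑ := by
          gcongr
          exact hm₂ _ _ hr0
      _ ≤ _ := by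
          rw [← ENNReal.ofReal_mul (by positivity)]
          refine mul_le_mul_left (ENNReal.ofReal_le_ofReal ?_) _
          nlinarith [mul_pos (mul_pos hC₁ hM₁) (by positivity : 0 < ε)]

/-- Summation of the previous bounds over `j`. -/
lemma exists_tsum_two_rpow_le : ∃ S : ℝ, 0 < S ∧ ∀ k : ℤ,
    ∑' j : ℕ, ENNReal.ofReal (2 ^ (-|(j : ℝ) - 2 * k| / 8)) ≤ ENNReal.ofReal S := by
  have hq : ∀ i : ℕ, (2 : ℝ) ^ (-|((i : ℤ) : ℝ)| / 8) = ((2 : ℝ) ^ (-(1 / 8) : ℝ)) ^ i := by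
    intro i
    rw [Int.cast_natCast, abs_of_nonneg (by positivity), ← Real.rpow_natCast,
      ← Real.rpow_mul two_pos.le]
    congr 1
    ring
  have hgeom : Summable fun i : ℕ => ((2 : ℝ) ^ (-(1 / 8) : ℝ)) ^ i :=
    summable_geometric_of_lt_one (by positivity)
      (Real.rpow_lt_one_of_one_lt_of_neg one_lt_two (by norm_num))
  have hsum : Summable fun m : ℤ => (2 : ℝ) ^ (-|(m : ℝ)| / 8) := by
    refine Summable.of_nat_of_neg ?_ ?_
    · simpa only [hq] using hgeom
    · simpa only [Int.cast_neg, abs_neg, hq] using hgeom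
  refine ⟨∑' m : ℤ, (2 : ℝ) ^ (-|(m : ℝ)| / 8), hsum.tsum_pos (fun _ => by positivity) 0
    (by positivity), fun k => ?_⟩
  rw [ENNReal.ofReal_tsum_of_nonneg (fun _ => by positivity) hsum]
  -- The shifted indices `j - 2k` are distinct integers, so the full sum over `ℤ` is a bound
  -- independent of `k`.
  have hinj : Function.Injective fun j : ℕ => (j : ℤ) - 2 * k := fun a b hab => by
    simpa using hab
  refine le_trans (le_of_eq ?_) (ENNReal.tsum_comp_le_tsum_of_injective hinj _)
  simp

end CubeEstimates

/-! ### The weak type estimate for continuous functions with compact support -/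

section WeakType

open scoped ENNReal
open Filter Topology

variable {n₁ n₂ : ℕ} {ϰ : ℕ}

lemma meas_ge_le_enorm_sq (h : L2 n₁ n₂) {c : ℝ≥0∞} (hc : c ≠ 0) :
    volume {x | c ≤ ‖h x‖ₑ} ≤ c⁻¹ ^ 2 * ‖h‖ₑ ^ 2 := by
  have := meas_ge_le_mul_pow_eLpNorm_enorm volume two_ne_zero ENNReal.ofNat_ne_top
    (Lp.aestronglyMeasurable h) hc (by simp)
  rw [Lp.enorm_def]
  simpa [ENNReal.rpow_two] using this

lemma eLpNorm_two_sq (f : Space n₁ n₂ → ℂ) :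
    eLpNorm f 2 volume ^ 2 = ∫⁻ x, ‖f x‖ₑ ^ 2 := by
  have := eLpNorm_nnreal_pow_eq_lintegral (μ := volume) (f := f) (p := 2) two_ne_zero
  simpa [ENNReal.rpow_two] using this

/-- `|T b| ≤ ∑_j |T_j b|` almost everywhere. -/
lemma enorm_apply_le_tsum (V : Potential) (T : L2 n₁ n₂ →L[ℂ] L2 n₁ n₂)
    {K : ℕ → Space n₁ n₂ → Space n₁ n₂ → ℂ}
    (hK : ∀ j, IsIntegralKernel (T.comp (chi n₁ n₂ ϰ V j)) (K j)) {b : Space n₁ n₂ → ℂ}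
    (hb : MemLp b 2 volume) (hc : HasCompactSupport b) :
    ∀ᵐ x, ‖T (hb.toLp b) x‖ₑ ≤ ∑' j, ‖∫ y, K j x y * b y‖ₑ := by
  have hlim : Tendsto (fun N => ∑ j ∈ Finset.range N, T (chi n₁ n₂ ϰ V j (hb.toLp b))) atTop
      (𝓝 (T (hb.toLp b))) := by
    have := (T.continuous.tendsto _).comp (tendsto_sum_chi n₁ n₂ ϰ V (hb.toLp b))
    refine this.congr fun N => ?_
    simp
  -- `L²` convergence gives almost everywhere convergence along a subsequence. This is enough, every
  -- partial sum being dominated by the full series of norms.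
  obtain ⟨ns, -, hns⟩ := (tendstoInMeasure_of_tendsto_Lp hlim).exists_seq_tendsto_ae
  have hk : ∀ᵐ x, ∀ j, T (chi n₁ n₂ ϰ V j (hb.toLp b)) x = ∫ y, K j x y * b y :=
    ae_all_iff.2 fun j => ((hK j).2 b hb hc).mono fun x hx => hx.2
  have hsum : ∀ᵐ x, ∀ N, (∑ j ∈ Finset.range N, T (chi n₁ n₂ ϰ V j (hb.toLp b)) : L2 n₁ n₂) x
      = ∑ j ∈ Finset.range N, T (chi n₁ n₂ ϰ V j (hb.toLp b)) x :=
    ae_all_iff.2 fun N => Lp.coeFn_fun_finsetSum _ _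
  filter_upwards [hns, hk, hsum] with x h1 h2 h3
  refine le_of_tendsto h1.enorm (Eventually.of_forall fun i => ?_)
  rw [h3]
  refine (enorm_sum_le _ _).trans ?_
  simp only [h2]
  exact ENNReal.sum_le_tsum _

lemma isHeavy_exists_ne_zero {f : Space n₁ n₂ → ℂ} {α : ℝ≥0∞} {k₀ : ℤ} {n : ℕ} {x : Space n₁ n₂}
    (h : IsHeavy volume (dyadicIdx ϰ k₀) f α n x) : ∃ y ∈ cube ϰ (k₀ + n) x, f y ≠ 0 := by
  by_contra! hz
  rw [IsHeavy, cell_dyadicIdx, setLIntegral_congr_fun (measurableSet_cube _ _ _) (g := 0)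
    fun y hy => by simp [hz y hy]] at h
  simp at h

/-- The bad part of the Calderón–Zygmund decomposition outside the dilated stopping cubes. -/
lemma exists_bad_part_bound (hn₁ : 1 ≤ n₁) (V : Potential) (T : L2 n₁ n₂ →L[ℂ] L2 n₁ n₂)
    {K : ℕ → Space n₁ n₂ → Space n₁ n₂ → ℂ}
    (hK : ∀ j, IsIntegralKernel (T.comp (chi n₁ n₂ ϰ V j)) (K j)) {R₀ : ℝ}
    (hR₀ : homDim n₁ n₂ ϰ + 1 / 2 ≤ R₀) (hsup : SupCondition ϰ R₀ K)
    (hgrad : GradSupCondition ϰ R₀ K) : ∃ C : ℝ, 0 < C ∧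
    ∀ (k₀ : ℤ) (f : Space n₁ n₂ → ℂ) (α : ℝ≥0∞) (b : Space n₁ n₂ → ℂ), Integrable b volume →
      ∀ hb2 : MemLp b 2 volume, HasCompactSupport b →
      (∀ x ∉ ⋃ p, stoppingCell volume (dyadicIdx ϰ k₀) f α p, b x = 0) →
      (∀ p, ∫ y in stoppingCell volume (dyadicIdx ϰ k₀) f α p, b y = 0) →
      ∃ Ω : Set (Space n₁ n₂), MeasurableSet Ω ∧
        volume Ω ≤ ENNReal.ofReal C *
          ∑' p, volume (stoppingCell volume (dyadicIdx ϰ k₀) f α p) ∧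
        ∫⁻ x in Ωᶜ, ‖T (hb2.toLp b) x‖ₑ ≤ ENNReal.ofReal C * ∫⁻ y, ‖b y‖ₑ := by
  obtain ⟨C₁, hC₁, hstar⟩ := exists_volume_star_le hn₁ n₂ ϰ
  obtain ⟨C₂, hC₂, hcube⟩ := exists_lintegral_compl_star_le hn₁ hR₀ (fun j => (hK j).1) hsup hgrad
  obtain ⟨C₃, hC₃, hsum⟩ := exists_tsum_two_rpow_le
  refine ⟨C₁ + C₂ * C₃, by positivity, fun k₀ f α b hb hb2 hbc hboff hb0 => ?_⟩
  set S := stoppingCell volume (dyadicIdx ϰ k₀) f α with hS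
  have hR := refining_dyadicIdx (n₁ := n₁) (n₂ := n₂) ϰ k₀
  have hm : ∀ n x, MeasurableSet (cell (dyadicIdx (n₁ := n₁) (n₂ := n₂) ϰ k₀) n x) := fun n x => by
    rw [cell_dyadicIdx]; exact measurableSet_cube _ _ _
  have hSm : ∀ p, MeasurableSet (S p) := measurableSet_stoppingCell hR hm
  have hdisj : Pairwise (Function.onFun Disjoint S) := pairwise_disjoint_stoppingCell
  have hW : ∀ p, ∃ W : Set (Space n₁ n₂), MeasurableSet W ∧
      volume W ≤ ENNReal.ofReal C₁ * volume (S p) ∧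
      ∀ j : ℕ, ∫⁻ x in Wᶜ, ‖∫ y in S p, K j x y * b y‖ₑ ≤
        ENNReal.ofReal (C₂ * 2 ^ (-|(j : ℝ) - 2 * ((k₀ + p.1 : ℤ) : ℝ)| / 8)) *
          ∫⁻ y in S p, ‖b y‖ₑ := by
    intro p
    rcases (S p).eq_empty_or_nonempty with h | ⟨x, hx⟩
    · exact ⟨∅, .empty, by simp, fun j => by simp [h]⟩
    · have hSx : S p = cube ϰ (k₀ + p.1) x := by
        rw [hS, stoppingCell_eq_cell hR hx, cell_dyadicIdx]
      refine ⟨star ϰ (k₀ + p.1) x, measurableSet_box _ _ _ _, ?_, fun j => ?_⟩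
      · rw [hSx]; exact hstar _ _
      · have h0 := hb0 p
        rw [hSx] at h0
        rw [hSx]
        exact hcube j _ x b hb.integrableOn h0
  choose W hWm hWvol hWint using hW
  refine ⟨⋃ p, W p, .iUnion hWm, ?_, ?_⟩
  · calc volume (⋃ p, W p) ≤ ∑' p, volume (W p) := measure_iUnion_le _
      _ ≤ ∑' p, ENNReal.ofReal C₁ * volume (S p) := ENNReal.tsum_le_tsum hWvol
      _ = ENNReal.ofReal C₁ * ∑' p, volume (S p) := ENNReal.tsum_mul_left
      _ ≤ _ := by
        refine mul_le_mul_left (ENNReal.ofReal_le_ofReal ?_) _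
        nlinarith [mul_pos hC₂ hC₃]
  · have hpt : ∀ᵐ x, ‖T (hb2.toLp b) x‖ₑ ≤ ∑' j, ∑' p, ‖∫ y in S p, K j x y * b y‖ₑ := by
      have hint : ∀ᵐ x, ∀ j, Integrable (fun y => K j x y * b y) volume :=
        ae_all_iff.2 fun j => ((hK j).2 b hb2 hbc).mono fun x hx => hx.1
      filter_upwards [enorm_apply_le_tsum V T hK hb2 hbc, hint] with x h1 h2
      refine h1.trans (ENNReal.tsum_le_tsum fun j => ?_)
      -- Integrability of the whole product allows splitting over all stopping cells at once,
      -- without decomposing `T b` into infinitely many pieces.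
      have h3 : ∫ y, K j x y * b y = ∑' p, ∫ y in S p, K j x y * b y := by
        rw [← integral_iUnion hSm hdisj (h2 j).integrableOn]
        refine (setIntegral_eq_integral_of_forall_compl_eq_zero fun y hy => ?_).symm
        rw [hboff y hy, mul_zero]
      rw [h3]
      exact enorm_tsum_le_tsum_enorm
    have hmeas : ∀ j p, AEMeasurable (fun x => ‖∫ y in S p, K j x y * b y‖ₑ)
        (volume.restrict (⋃ p, W p)ᶜ) := by
      intro j p
      have h1 : AEStronglyMeasurable (fun q : Space n₁ n₂ × Space n₁ n₂ => K j q.1 q.2 * b q.2)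
          (volume.prod (volume.restrict (S p))) := by
        refine AEStronglyMeasurable.mul ?_ hb.1.restrict.comp_snd
        have h2 := ((hK j).1).restrict (s := Set.univ ×ˢ S p)
        rw [← Measure.prod_restrict, Measure.restrict_univ] at h2
        exact h2
      exact h1.integral_prod_right'.enorm.restrict
    calc ∫⁻ x in (⋃ p, W p)ᶜ, ‖T (hb2.toLp b) x‖ₑ
        ≤ ∫⁻ x in (⋃ p, W p)ᶜ, ∑' j, ∑' p, ‖∫ y in S p, K j x y * b y‖ₑ :=
          lintegral_mono_ae (ae_restrict_of_ae hpt)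
      _ = ∑' j, ∑' p, ∫⁻ x in (⋃ p, W p)ᶜ, ‖∫ y in S p, K j x y * b y‖ₑ := by
          rw [lintegral_tsum fun j => AEMeasurable.tsum fun p => hmeas j p]
          exact tsum_congr fun j => lintegral_tsum fun p => hmeas j p
      _ ≤ ∑' j : ℕ, ∑' p,
            ENNReal.ofReal (C₂ * 2 ^ (-|(j : ℝ) - 2 * ((k₀ + p.1 : ℤ) : ℝ)| / 8)) *
              ∫⁻ y in S p, ‖b y‖ₑ := by
          refine ENNReal.tsum_le_tsum fun j => ENNReal.tsum_le_tsum fun p => ?_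
          exact (lintegral_mono_set (Set.compl_subset_compl.2 (Set.subset_iUnion W p))).trans
            (hWint p j)
      _ = ∑' p, ENNReal.ofReal C₂ * (∑' j : ℕ, ENNReal.ofReal
            (2 ^ (-|(j : ℝ) - 2 * ((k₀ + p.1 : ℤ) : ℝ)| / 8))) * ∫⁻ y in S p, ‖b y‖ₑ := by
          rw [ENNReal.tsum_comm]
          refine tsum_congr fun p => ?_
          rw [ENNReal.tsum_mul_right, ← ENNReal.tsum_mul_left]
          simp only [ENNReal.ofReal_mul hC₂.le]
      _ ≤ ∑' p, ENNReal.ofReal C₂ * ENNReal.ofReal C₃ * ∫⁻ y in S p, ‖b y‖ₑ := by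
          refine ENNReal.tsum_le_tsum fun p => ?_
          gcongr
          exact hsum _
      _ = ENNReal.ofReal C₂ * ENNReal.ofReal C₃ * ∑' p, ∫⁻ y in S p, ‖b y‖ₑ :=
          ENNReal.tsum_mul_left
      _ ≤ ENNReal.ofReal C₂ * ENNReal.ofReal C₃ * ∫⁻ y, ‖b y‖ₑ := by
          gcongr
          exact tsum_lintegral_stoppingCell_le hR hm _
      _ ≤ _ := by
          rw [← ENNReal.ofReal_mul hC₂.le]
          refine mul_le_mul_left (ENNReal.ofReal_le_ofReal ?_) _
          linarith

/-- The weak type bound for continuous functions with compact support. -/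
lemma exists_weak_type_of_continuous (hn₁ : 1 ≤ n₁) (V : Potential)
    (T : L2 n₁ n₂ →L[ℂ] L2 n₁ n₂) {K : ℕ → Space n₁ n₂ → Space n₁ n₂ → ℂ}
    (hK : ∀ j, IsIntegralKernel (T.comp (chi n₁ n₂ ϰ V j)) (K j)) {R₀ : ℝ}
    (hR₀ : homDim n₁ n₂ ϰ + 1 / 2 ≤ R₀) (hsup : SupCondition ϰ R₀ K)
    (hgrad : GradSupCondition ϰ R₀ K) : ∃ C : ℝ, 0 < C ∧
    ∀ (f : Space n₁ n₂ → ℂ) (hf2 : MemLp f 2 volume), Continuous f → HasCompactSupport f →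
      ∀ ε : ℝ, 0 < ε →
      volume {x | ε < ‖T (hf2.toLp f) x‖} ≤ ENNReal.ofReal (C / ε) * ∫⁻ x, ‖f x‖ₑ := by
  obtain ⟨C₁, hC₁, hbad⟩ := exists_bad_part_bound hn₁ V T hK hR₀ hsup hgrad
  set D : ℝ := 2 ^ n₁ * (2 ^ (1 + ϰ)) ^ n₂ with hD
  have hD1 : 1 ≤ D := one_le_mul_of_one_le_of_one_le (one_le_pow₀ one_le_two)
    (one_le_pow₀ (one_le_pow₀ one_le_two))
  -- The three terms come from Chebyshev in `L²` for `g` at level `ε/2`, from the measure of `Ω`,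
  -- and from Chebyshev in `L¹` for `b` with `‖b‖₁ ≤ 2‖f‖₁`.
  refine ⟨4 * ‖T‖ ^ 2 * D + C₁ + 4 * C₁, by positivity, fun f hf2 hfc hfs ε hε => ?_⟩
  have hf1 : Integrable f volume := hfc.integrable_of_hasCompactSupport hfs
  set I : ℝ≥0∞ := ∫⁻ x, ‖f x‖ₑ with hI
  have hItop : I ≠ ⊤ := hf1.2.ne
  set α : ℝ≥0∞ := ENNReal.ofReal ε with hα
  have hα0 : α ≠ 0 := by simpa [hα] using hε
  have hαtop : α ≠ ⊤ := ENNReal.ofReal_ne_top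
  -- Starting at scale `2^{n₀}`, every cube has measure at least `2^{n₀}`, so no initial cube is
  -- heavy.
  obtain ⟨n₀, hn₀⟩ : ∃ n₀ : ℕ, I ≤ α * ENNReal.ofReal (2 ^ n₀) := by
    obtain ⟨n₀, hn₀⟩ := pow_unbounded_of_one_lt (I.toReal / ε) one_lt_two
    refine ⟨n₀, ?_⟩
    rw [div_lt_iff₀' hε] at hn₀
    rw [← ENNReal.ofReal_mul hε.le, ← ENNReal.ofReal_toReal hItop]
    exact ENNReal.ofReal_le_ofReal hn₀.le
  set k₀ : ℤ := -(n₀ : ℤ) with hk₀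
  have hR := refining_dyadicIdx (n₁ := n₁) (n₂ := n₂) ϰ k₀
  have hm : ∀ n x, MeasurableSet (cell (dyadicIdx (n₁ := n₁) (n₂ := n₂) ϰ k₀) n x) := fun n x => by
    rw [cell_dyadicIdx]; exact measurableSet_cube _ _ _
  have hfin : ∀ n x, volume (cell (dyadicIdx (n₁ := n₁) (n₂ := n₂) ϰ k₀) n x) ≠ ⊤ := fun n x => by
    rw [cell_dyadicIdx]; exact volume_cube_ne_top _ _ _
  have hpos : ∀ n x, volume (cell (dyadicIdx (n₁ := n₁) (n₂ := n₂) ϰ k₀) n x) ≠ 0 := fun n x => by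
    rw [cell_dyadicIdx]; exact volume_cube_ne_zero _ _ _
  have hdbl : ∀ n x, volume (cell (dyadicIdx (n₁ := n₁) (n₂ := n₂) ϰ k₀) n x)
      ≤ ENNReal.ofReal D * volume (cell (dyadicIdx ϰ k₀) (n + 1) x) := fun n x => by
    rw [cell_dyadicIdx, cell_dyadicIdx]
    push_cast
    rw [← add_assoc]
    exact volume_cube_le_succ _ _ _
  have h0 : ∀ x, ¬ IsHeavy volume (dyadicIdx ϰ k₀) f α 0 x := fun x => by
    rw [IsHeavy, not_lt, cell_dyadicIdx, Nat.cast_zero, add_zero]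
    refine (setLIntegral_le_lintegral _ _).trans (hn₀.trans ?_)
    gcongr
    exact le_volume_cube hn₁ ϰ n₀ x
  have hlim : ∀ x, (∀ n, ¬ IsHeavy volume (dyadicIdx ϰ k₀) f α n x) → ‖f x‖ₑ ≤ α := by
    intro x hx
    by_contra! hlt
    -- By continuity `|f| > β > α` on a small cube around `x`, which is then heavy.
    obtain ⟨β, hβ1, hβ2⟩ := exists_between hlt
    have hopen : ∀ᶠ y in 𝓝 x, β < ‖f y‖ₑ :=
      (hfc.enorm.tendsto x).eventually (lt_mem_nhds hβ2)
    obtain ⟨δ, hδ, hball⟩ := Metric.eventually_nhds_iff_ball.1 hopen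
    obtain ⟨n, hn⟩ := exists_cube_subset_ball hn₁ ϰ k₀ x hδ
    refine hx n ?_
    rw [IsHeavy]
    calc α * volume (cell (dyadicIdx ϰ k₀) n x) < β * volume (cell (dyadicIdx ϰ k₀) n x) :=
          ENNReal.mul_lt_mul_left (hpos n x) (hfin n x) hβ1
      _ = ∫⁻ _ in cell (dyadicIdx ϰ k₀) n x, β := (setLIntegral_const _ _).symm
      _ ≤ _ := by
        refine setLIntegral_mono_ae' (hm n x) (Eventually.of_forall fun y hy => ?_)
        rw [cell_dyadicIdx] at hy
        exact (hball y (hn hy)).le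
  set g := goodPart volume (dyadicIdx ϰ k₀) f α with hg
  set b : Space n₁ n₂ → ℂ := f - g with hb
  have hgm : AEStronglyMeasurable g volume := aestronglyMeasurable_goodPart hR hm hf1.1
  have hgsup : ∀ x, ‖g x‖ₑ ≤ ENNReal.ofReal D * α :=
    enorm_goodPart_le hR hpos hfin hdbl h0 (by simpa using hD1) hlim
  have hg1 : ∫⁻ x, ‖g x‖ₑ ≤ I := lintegral_goodPart_le hR hm hfin
  have hgint : Integrable g volume := ⟨hgm, hg1.trans_lt hItop.lt_top⟩
  have hgsq : eLpNorm g 2 volume ^ 2 ≤ ENNReal.ofReal D * α * I := by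
    rw [eLpNorm_two_sq]
    calc ∫⁻ x, ‖g x‖ₑ ^ 2 ≤ ∫⁻ x, ENNReal.ofReal D * α * ‖g x‖ₑ := by
          refine lintegral_mono fun x => ?_
          rw [sq]
          exact mul_le_mul_left (hgsup x) _
      _ = ENNReal.ofReal D * α * ∫⁻ x, ‖g x‖ₑ := lintegral_const_mul'' _ hgm.enorm
      _ ≤ _ := by gcongr
  have hg2 : MemLp g 2 volume := by
    refine ⟨hgm, ?_⟩
    have h1 : eLpNorm g 2 volume ^ 2 < ⊤ := hgsq.trans_lt (by finiteness)
    exact (ENNReal.pow_lt_top_iff.1 h1).resolve_right two_ne_zero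
  have hbint : Integrable b volume := hf1.sub hgint
  have hb2 : MemLp b 2 volume := hf2.sub hg2
  have hboff : ∀ x ∉ ⋃ p, stoppingCell volume (dyadicIdx ϰ k₀) f α p, b x = 0 := fun x hx => by
    rw [hb, Pi.sub_apply, hg, goodPart_of_notMem hx, sub_self]
  have hbc : HasCompactSupport b := by
    obtain ⟨R, hR0⟩ := hfs.isCompact.isBounded.exists_norm_le
    obtain ⟨R', hR'⟩ := exists_cube_subset_closedBall (n₂ := n₂) hn₁ ϰ k₀ R
    -- A stopping cube meets the support of `f` and lies in a cube of the initial scale, so the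
    -- stopping cubes stay in a bounded set.
    refine HasCompactSupport.intro (isCompact_closedBall 0 R') fun x hx => hboff x fun hxS => hx ?_
    obtain ⟨p, hp⟩ := Set.mem_iUnion.1 hxS
    obtain ⟨y, hy, hfy⟩ := isHeavy_exists_ne_zero hp.2.1
    have h1 : dyadicIdx ϰ k₀ 0 y = dyadicIdx ϰ k₀ 0 x :=
      hR.le (Nat.zero_le p.1) (dyadicIdx_eq_iff.2 hy)
    have h2 := dyadicIdx_eq_iff.1 h1.symm
    rw [Nat.cast_zero, add_zero] at h2
    exact hR' y (hR0 y (subset_tsupport f hfy)) h2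
  obtain ⟨Ω, hΩm, hΩvol, hΩint⟩ := hbad k₀ f α b hbint hb2 hbc hboff
    fun p => setIntegral_sub_goodPart hR hm hfin p
  set c : ℝ≥0∞ := ENNReal.ofReal (ε / 2) with hc
  have hc0 : c ≠ 0 := by simpa [hc] using hε
  have hcinv : c⁻¹ = ENNReal.ofReal (2 / ε) := by
    rw [hc, ← ENNReal.ofReal_inv_of_pos (by positivity), inv_div]
  have hαinv : α⁻¹ = ENNReal.ofReal (1 / ε) := by
    rw [hα, ← ENNReal.ofReal_inv_of_pos hε, one_div]
  have hsplit : T (hf2.toLp f) = T (hg2.toLp g) + T (hb2.toLp b) := by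
    rw [← map_add, ← MemLp.toLp_add]
    congr 1
    exact MemLp.toLp_congr _ _ (Eventually.of_forall fun x => by simp [hb])
  have hae : ∀ᵐ x, T (hf2.toLp f) x = T (hg2.toLp g) x + T (hb2.toLp b) x := by
    rw [hsplit]; exact Lp.coeFn_add _ _
  have hsub : ({x | ε < ‖T (hf2.toLp f) x‖} : Set (Space n₁ n₂)) ≤ᵐ[volume]
      (({x | c ≤ ‖T (hg2.toLp g) x‖ₑ} ∪ Ω) ∪ ({x | c ≤ ‖T (hb2.toLp b) x‖ₑ} ∩ Ωᶜ) :
        Set (Space n₁ n₂)) := by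
    filter_upwards [hae] with x hx (hxε : ε < ‖T (hf2.toLp f) x‖)
    rw [hx] at hxε
    by_cases hxΩ : x ∈ Ω
    · exact Or.inl (Or.inr hxΩ)
    rcases le_or_gt (ε / 2) ‖T (hg2.toLp g) x‖ with h1 | h1
    · refine Or.inl (Or.inl ?_)
      change c ≤ ‖T (hg2.toLp g) x‖ₑ
      rw [← ofReal_norm]
      exact ENNReal.ofReal_le_ofReal h1
    · refine Or.inr ⟨?_, hxΩ⟩
      change c ≤ ‖T (hb2.toLp b) x‖ₑ
      rw [← ofReal_norm]
      refine ENNReal.ofReal_le_ofReal ?_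
      have := norm_add_le (T (hg2.toLp g) x) (T (hb2.toLp b) x)
      linarith
  have e1 : volume {x | c ≤ ‖T (hg2.toLp g) x‖ₑ} ≤ ENNReal.ofReal (4 * ‖T‖ ^ 2 * D / ε) * I := by
    refine (meas_ge_le_enorm_sq _ hc0).trans ?_
    have h1 : ‖T (hg2.toLp g)‖ₑ ^ 2 ≤ ENNReal.ofReal (‖T‖ ^ 2) * (ENNReal.ofReal D * α * I) := by
      calc ‖T (hg2.toLp g)‖ₑ ^ 2 ≤ (‖T‖ₑ * ‖hg2.toLp g‖ₑ) ^ 2 := by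
            gcongr; exact T.le_opENorm _
        _ = ENNReal.ofReal (‖T‖ ^ 2) * eLpNorm g 2 volume ^ 2 := by
            rw [mul_pow, Lp.enorm_toLp, ← ofReal_norm, ENNReal.ofReal_pow (norm_nonneg _)]
        _ ≤ _ := by gcongr
    calc c⁻¹ ^ 2 * ‖T (hg2.toLp g)‖ₑ ^ 2
        ≤ c⁻¹ ^ 2 * (ENNReal.ofReal (‖T‖ ^ 2) * (ENNReal.ofReal D * α * I)) := by gcongr
      _ = ENNReal.ofReal (4 * ‖T‖ ^ 2 * D / ε) * I := by
        rw [hcinv, ← ENNReal.ofReal_pow (by positivity), hα, ← ENNReal.ofReal_mul (by positivity),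
          ← mul_assoc, ← ENNReal.ofReal_mul (by positivity), ← mul_assoc,
          ← ENNReal.ofReal_mul (by positivity)]
        congr 2
        field_simp
        ring
  have e2 : volume Ω ≤ ENNReal.ofReal (C₁ / ε) * I := by
    refine hΩvol.trans ?_
    have h1 : ∑' p, volume (stoppingCell volume (dyadicIdx (n₁ := n₁) (n₂ := n₂) ϰ k₀) f α p)
        ≤ α⁻¹ * I := by
      calc _ = α⁻¹ * ∑' p, α * volume (stoppingCell volume
              (dyadicIdx (n₁ := n₁) (n₂ := n₂) ϰ k₀) f α p) := by
            rw [ENNReal.tsum_mul_left, ← mul_assoc, ENNReal.inv_mul_cancel hα0 hαtop, one_mul]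
        _ ≤ α⁻¹ * ∑' p, ∫⁻ y in stoppingCell volume
              (dyadicIdx (n₁ := n₁) (n₂ := n₂) ϰ k₀) f α p, ‖f y‖ₑ := by
            gcongr with p
            exact mul_measure_stoppingCell_le hR p
        _ ≤ _ := by
            gcongr
            exact tsum_lintegral_stoppingCell_le hR hm _
    calc _ ≤ ENNReal.ofReal C₁ * (α⁻¹ * I) := by gcongr
      _ = _ := by
        rw [hαinv, ← mul_assoc, ← ENNReal.ofReal_mul hC₁.le, mul_one_div]
  have e3 : volume ({x | c ≤ ‖T (hb2.toLp b) x‖ₑ} ∩ Ωᶜ) ≤ ENNReal.ofReal (4 * C₁ / ε) * I := by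
    have h1 : ∫⁻ y, ‖b y‖ₑ ≤ 2 * I := by
      calc ∫⁻ y, ‖b y‖ₑ ≤ ∫⁻ y, (‖f y‖ₑ + ‖g y‖ₑ) := lintegral_mono fun y => enorm_sub_le
        _ = I + ∫⁻ y, ‖g y‖ₑ := lintegral_add_left' hf1.1.enorm _
        _ ≤ I + I := by gcongr
        _ = 2 * I := (two_mul I).symm
    have h2 := mul_meas_ge_le_lintegral₀ (μ := volume.restrict Ωᶜ)
      (Lp.aestronglyMeasurable (T (hb2.toLp b))).enorm.restrict c
    rw [Measure.restrict_apply' hΩm.compl] at h2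
    calc volume ({x | c ≤ ‖T (hb2.toLp b) x‖ₑ} ∩ Ωᶜ)
        = c⁻¹ * (c * volume ({x | c ≤ ‖T (hb2.toLp b) x‖ₑ} ∩ Ωᶜ)) := by
          rw [← mul_assoc, ENNReal.inv_mul_cancel hc0 ENNReal.ofReal_ne_top, one_mul]
      _ ≤ c⁻¹ * (ENNReal.ofReal C₁ * (ENNReal.ofReal 2 * I)) := by
          refine mul_le_mul_right (h2.trans (hΩint.trans (mul_le_mul_right ?_ _))) _
          simpa using h1
      _ = _ := by
          rw [hcinv, ← mul_assoc, ← mul_assoc, ← ENNReal.ofReal_mul (by positivity),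
            ← ENNReal.ofReal_mul (by positivity)]
          congr 2
          ring
  calc volume {x | ε < ‖T (hf2.toLp f) x‖} ≤ _ := measure_mono_ae hsub
    _ ≤ (volume {x | c ≤ ‖T (hg2.toLp g) x‖ₑ} + volume Ω) +
          volume ({x | c ≤ ‖T (hb2.toLp b) x‖ₑ} ∩ Ωᶜ) :=
        (measure_union_le _ _).trans (add_le_add_left (measure_union_le _ _) _)
    _ ≤ ENNReal.ofReal (4 * ‖T‖ ^ 2 * D / ε) * I + ENNReal.ofReal (C₁ / ε) * I +
          ENNReal.ofReal (4 * C₁ / ε) * I := add_le_add (add_le_add e1 e2) e3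
    _ = _ := by
        rw [← add_mul, ← add_mul, ← ENNReal.ofReal_add (by positivity) (by positivity),
          ← ENNReal.ofReal_add (by positivity) (by positivity), ← add_div, ← add_div]

end WeakType

/-! ### Density of continuous functions with compact support, and the theorem -/

section Density

open scoped ENNReal
open Filter Topology

/-- Any approximant vanishing off `N` has error at least the tail of `f` off `N`. -/
lemma eLpNorm_indicator_compl_le {α : Type*} [MeasurableSpace α] {μ : Measure α}
    {f g : α → ℂ} {p : ℝ≥0∞} {N : Set α}
    (hg : ∀ x ∉ N, g x = 0) : eLpNorm (Nᶜ.indicator f) p μ ≤ eLpNorm (f - g) p μ := by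
  refine eLpNorm_mono fun x => ?_
  by_cases hx : x ∈ N
  · simp [hx]
  · simp [hx, hg x hx]

variable {E : Type*} [NormedAddCommGroup E] [NormedSpace ℝ E] [FiniteDimensional ℝ E]
  [MeasurableSpace E] [BorelSpace E] {μ : Measure E} [μ.Regular]

/-- Simultaneous approximation in `L¹` and `L²` by continuous functions with compact support. -/
lemma exists_continuous_approx {f : E → ℂ} (h1 : MemLp f 1 μ) (h2 : MemLp f 2 μ) {η : ℝ≥0∞}
    (hη : η ≠ 0) : ∃ g : E → ℂ, Continuous g ∧ HasCompactSupport g ∧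
      eLpNorm (f - g) 1 μ ≤ η ∧ eLpNorm (f - g) 2 μ ≤ η := by
  have hη2 : η / 2 ≠ 0 := by simpa using hη
  -- These two approximants serve only to find a ball `N` off which `f` is small in both norms.
  obtain ⟨g₁, hg₁s, hg₁, -, -⟩ := h1.exists_hasCompactSupport_eLpNorm_sub_le (by simp) hη2
  obtain ⟨g₂, hg₂s, hg₂, -, -⟩ := h2.exists_hasCompactSupport_eLpNorm_sub_le (by simp) hη2
  obtain ⟨R, hR⟩ := (hg₁s.isCompact.union hg₂s.isCompact).isBounded.exists_norm_le
  set N : Set E := Metric.closedBall 0 R with hN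
  have hNm : MeasurableSet N := Metric.isClosed_closedBall.measurableSet
  have hz₁ : ∀ x ∉ N, g₁ x = 0 := fun x hx => by
    by_contra h
    exact hx (mem_closedBall_zero_iff.2 (hR x (Or.inl (subset_tsupport _ h))))
  have hz₂ : ∀ x ∉ N, g₂ x = 0 := fun x hx => by
    by_contra h
    exact hx (mem_closedBall_zero_iff.2 (hR x (Or.inr (subset_tsupport _ h))))
  set B : Set E := Metric.closedBall 0 (R + 1) with hB
  have hBm : MeasurableSet B := Metric.isClosed_closedBall.measurableSet
  have hBfin : μ B < ⊤ := (isCompact_closedBall _ _).measure_lt_top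
  -- By Cauchy–Schwarz on `B`, an `L²` error `θ` costs at most `θ μ(B)^{1/2}` in `L¹`; this `θ`
  -- serves both norms.
  set θ : ℝ≥0∞ := η / 2 / (1 + μ B ^ (1 / 2 : ℝ)) with hθ
  have hden : 1 + μ B ^ (1 / 2 : ℝ) ≠ ⊤ := by finiteness
  have hθ0 : θ ≠ 0 := (ENNReal.div_pos hη2 hden).ne'
  have hθη : θ * (1 + μ B ^ (1 / 2 : ℝ)) ≤ η / 2 := (ENNReal.div_mul_cancel (by simp) hden).le
  obtain ⟨u, -, hu, huc, hum⟩ :=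
    (h2.indicator hNm).exists_hasCompactSupport_eLpNorm_sub_le (by simp) hθ0
  set χ : E → ℝ := fun x => max 0 (min 1 (R + 1 - ‖x‖)) with hχ
  have hχc : Continuous χ := by fun_prop
  have hχ1 : ∀ x ∈ N, χ x = 1 := fun x hx => by
    have : ‖x‖ ≤ R := mem_closedBall_zero_iff.1 hx
    simp only [hχ]
    rw [min_eq_left (by linarith), max_eq_right zero_le_one]
  have hχ0 : ∀ x ∉ B, χ x = 0 := fun x hx => by
    have : R + 1 < ‖x‖ := by simpa [hB] using hx
    simp only [hχ]
    exact max_eq_left ((min_le_right _ _).trans (by linarith))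
  have hχle : ∀ x, |χ x| ≤ 1 := fun x => by
    rw [abs_of_nonneg (le_max_left _ _)]
    exact max_le zero_le_one (min_le_left _ _)
  set g : E → ℂ := fun x => (χ x : ℂ) * u x with hg
  have hgc : Continuous g := (Complex.continuous_ofReal.comp hχc).mul huc
  have hgs : HasCompactSupport g := HasCompactSupport.intro (isCompact_closedBall 0 (R + 1))
    fun x hx => by simp [hg, hχ0 x hx]
  set w : E → ℂ := N.indicator f - g with hw
  have hwm : AEStronglyMeasurable w μ :=
    (h2.1.indicator hNm).sub hgc.aestronglyMeasurable
  have hdecomp : f - g = Nᶜ.indicator f + w := by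
    rw [hw, ← add_sub_assoc, Set.indicator_compl_add_self]
  have hwle : ∀ x, ‖w x‖ ≤ ‖(N.indicator f - u) x‖ := fun x => by
    -- The cut-off equals `1` on `N`, so truncating `u` does not increase its error.
    have : w x = (χ x : ℂ) * ((N.indicator f - u) x) := by
      simp only [hw, hg, Pi.sub_apply]
      by_cases hx : x ∈ N
      · simp [hχ1 x hx]
      · simp [hx]
    rw [this, norm_mul, Complex.norm_real]
    exact mul_le_of_le_one_left (norm_nonneg _) (hχle x)
  have hw0 : ∀ x ∉ B, w x = 0 := fun x hx => by
    have hxN : x ∉ N := fun h => hx (Metric.closedBall_subset_closedBall (by linarith) h)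
    simp [hw, hg, hχ0 x hx, hxN]
  have hw2 : eLpNorm w 2 μ ≤ θ := (eLpNorm_mono hwle).trans hu
  have hw1 : eLpNorm w 1 μ ≤ θ * μ B ^ (1 / 2 : ℝ) := by
    have e : B.indicator w = w := Set.indicator_eq_self.2 fun x hx => by
      by_contra h; exact hx (hw0 x h)
    calc eLpNorm w 1 μ = eLpNorm w 1 (μ.restrict B) := by
          rw [← eLpNorm_indicator_eq_eLpNorm_restrict hBm, e]
      _ ≤ eLpNorm w 2 (μ.restrict B) *
          μ.restrict B Set.univ ^ (1 / (1 : ℝ≥0∞).toReal - 1 / (2 : ℝ≥0∞).toReal) :=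
          eLpNorm_le_eLpNorm_mul_rpow_measure_univ one_le_two hwm.restrict
      _ ≤ θ * μ B ^ (1 / 2 : ℝ) := by
          have : 1 / (1 : ℝ≥0∞).toReal - 1 / (2 : ℝ≥0∞).toReal = (1 / 2 : ℝ) := by norm_num
          rw [this, Measure.restrict_apply_univ]
          gcongr
          exact (eLpNorm_mono_measure _ Measure.restrict_le_self).trans hw2
  have hcm : AEStronglyMeasurable (Nᶜ.indicator f) μ := h2.1.indicator hNm.compl
  refine ⟨g, hgc, hgs, ?_, ?_⟩
  · rw [hdecomp]
    calc _ ≤ eLpNorm (Nᶜ.indicator f) 1 μ + eLpNorm w 1 μ := eLpNorm_add_le hcm hwm le_rfl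
      _ ≤ η / 2 + η / 2 := by
        refine add_le_add ((eLpNorm_indicator_compl_le hz₁).trans hg₁) (hw1.trans (le_trans ?_ hθη))
        gcongr
        exact le_add_self
      _ = η := ENNReal.add_halves η
  · rw [hdecomp]
    calc _ ≤ eLpNorm (Nᶜ.indicator f) 2 μ + eLpNorm w 2 μ := eLpNorm_add_le hcm hwm one_le_two
      _ ≤ η / 2 + η / 2 := by
        refine add_le_add ((eLpNorm_indicator_compl_le hz₂).trans hg₂) (hw2.trans (le_trans ?_ hθη))
        exact le_mul_of_one_le_right' le_self_add
      _ = η := ENNReal.add_halves η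

end Density

/-! ### Passage from continuous functions with compact support to `L¹ ∩ L²`. -/

section Extension

open scoped ENNReal
open Filter Topology

variable {n₁ n₂ : ℕ}

/-- A weak type bound for continuous functions with compact support extends to `L¹ ∩ L²`. -/
lemma isWeakTypeOneOne_of_continuous (T : L2 n₁ n₂ →L[ℂ] L2 n₁ n₂) {C : ℝ} (hC : 0 < C)
    (h : ∀ (f : Space n₁ n₂ → ℂ) (hf2 : MemLp f 2 volume), Continuous f → HasCompactSupport f →
      ∀ ε : ℝ, 0 < ε →
      volume {x | ε < ‖T (hf2.toLp f) x‖} ≤ ENNReal.ofReal (C / ε) * ∫⁻ x, ‖f x‖ₑ) :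
    IsWeakTypeOneOne T := by
  refine ⟨2 * C, fun f hf ε hε => ?_⟩
  set I : ℝ≥0∞ := ∫⁻ x, ‖f x‖ₑ with hI
  have hrhs : ENNReal.ofReal (2 * C / ε * ∫ x, ‖f x‖) = ENNReal.ofReal (C / (ε / 2)) * I := by
    rw [ENNReal.ofReal_mul (by positivity), ofReal_integral_norm_eq_lintegral_enorm hf]
    congr 2
    field_simp
  rw [hrhs]
  set c : ℝ≥0∞ := ENNReal.ofReal (ε / 2) with hc
  have hc0 : c ≠ 0 := by simpa [hc] using hε
  have hcinv : c⁻¹ ≠ ⊤ := by simpa using hc0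
  -- The approximant takes half of the level, whence `2 * C`. The remainder is controlled by the
  -- `L²` bound and disappears as `η → 0` with `ε` fixed.
  have key : ∀ η : ℝ≥0∞, η ≠ 0 → volume {x | ε < ‖T f x‖}
      ≤ ENNReal.ofReal (C / (ε / 2)) * (I + η) + c⁻¹ ^ 2 * (‖T‖ₑ * η) ^ 2 := by
    intro η hη
    obtain ⟨g, hgc, hgs, hg1, hg2⟩ :=
      exists_continuous_approx (memLp_one_iff_integrable.2 hf) (Lp.memLp f) hη
    have hgm : MemLp g 2 volume := hgc.memLp_of_hasCompactSupport hgs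
    set u : L2 n₁ n₂ := f - hgm.toLp g with hu
    have hun : ‖u‖ₑ ≤ η := by
      rw [Lp.enorm_def]
      refine (le_of_eq (eLpNorm_congr_ae ?_)).trans hg2
      filter_upwards [Lp.coeFn_sub f (hgm.toLp g), hgm.coeFn_toLp] with x hx1 hx2
      rw [hx1, Pi.sub_apply, Pi.sub_apply, hx2]
    have hae : ∀ᵐ x, T f x = T (hgm.toLp g) x + T u x := by
      have : T f = T (hgm.toLp g) + T u := by rw [← map_add, hu, add_sub_cancel]
      rw [this]; exact Lp.coeFn_add _ _
    have hsub : ({x | ε < ‖T f x‖} : Set (Space n₁ n₂)) ≤ᵐ[volume]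
        ({x | ε / 2 < ‖T (hgm.toLp g) x‖} ∪ {x | c ≤ ‖T u x‖ₑ} : Set (Space n₁ n₂)) := by
      filter_upwards [hae] with x hx (hxε : ε < ‖T f x‖)
      rw [hx] at hxε
      rcases lt_or_ge (ε / 2) ‖T (hgm.toLp g) x‖ with h1 | h1
      · exact Or.inl h1
      · refine Or.inr ?_
        change c ≤ ‖T u x‖ₑ
        rw [← ofReal_norm]
        refine ENNReal.ofReal_le_ofReal ?_
        have := norm_add_le (T (hgm.toLp g) x) (T u x)
        linarith
    calc volume {x | ε < ‖T f x‖} ≤ _ := measure_mono_ae hsub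
      _ ≤ volume {x | ε / 2 < ‖T (hgm.toLp g) x‖} + volume {x | c ≤ ‖T u x‖ₑ} :=
          measure_union_le _ _
      _ ≤ _ := by
        refine add_le_add ((h g hgm hgc hgs (ε / 2) (by positivity)).trans ?_)
          ((meas_ge_le_enorm_sq _ hc0).trans ?_)
        · gcongr
          calc ∫⁻ x, ‖g x‖ₑ ≤ ∫⁻ x, (‖f x‖ₑ + ‖(f - g : Space n₁ n₂ → ℂ) x‖ₑ) := by
                refine lintegral_mono fun x => ?_
                have : g x = f x - (f - g : Space n₁ n₂ → ℂ) x := by simp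
                conv_lhs => rw [this]
                exact enorm_sub_le
            _ = I + ∫⁻ x, ‖(f - g : Space n₁ n₂ → ℂ) x‖ₑ := lintegral_add_left' hf.1.enorm _
            _ ≤ I + η := by
                gcongr
                rwa [eLpNorm_one_eq_lintegral_enorm] at hg1
        · gcongr
          exact (T.le_opENorm u).trans (by gcongr)
  have hlim : Tendsto (fun η : ℝ≥0∞ => ENNReal.ofReal (C / (ε / 2)) * (I + η) +
      c⁻¹ ^ 2 * (‖T‖ₑ * η) ^ 2) (𝓝[>] 0) (𝓝 (ENNReal.ofReal (C / (ε / 2)) * I)) := by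
    have hcont : Continuous fun η : ℝ≥0∞ => ENNReal.ofReal (C / (ε / 2)) * (I + η) +
        c⁻¹ ^ 2 * (‖T‖ₑ * η) ^ 2 := by
      refine Continuous.add ?_ ?_
      · exact (ENNReal.continuous_const_mul ENNReal.ofReal_ne_top).comp
          (continuous_const.add continuous_id)
      · refine (ENNReal.continuous_const_mul (by finiteness)).comp ?_
        exact (ENNReal.continuous_pow 2).comp (ENNReal.continuous_const_mul enorm_ne_top)
    have := (hcont.tendsto 0).mono_left (nhdsWithin_le_nhds (s := Set.Ioi 0))
    simpa using this
  refine ge_of_tendsto hlim ?_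
  filter_upwards [self_mem_nhdsWithin] with η hη
  exact key η (ne_of_gt hη)

end Extension

end Grushin

end

theorem mainTheorem8 (n₁ n₂ ϰ : ℕ) (hn₁ : 1 ≤ n₁) (hn₂ : 1 ≤ n₂) (hϰ : 1 ≤ ϰ)
    (V : Grushin.Potential)
    (T : Grushin.L2 n₁ n₂ →L[ℂ] Grushin.L2 n₁ n₂)
    (K : ℕ → Grushin.Space n₁ n₂ → Grushin.Space n₁ n₂ → ℂ)
    (hK : ∀ j, Grushin.IsIntegralKernel (T.comp (Grushin.chi n₁ n₂ ϰ V j)) (K j))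
    (R₀ : ℝ) (hR₀ : Grushin.homDim n₁ n₂ ϰ + 1 / 2 ≤ R₀)
    (hsup : Grushin.SupCondition ϰ R₀ K)
    (hgrad : Grushin.GradSupCondition ϰ R₀ K) :
    Grushin.IsWeakTypeOneOne T := by
  obtain ⟨C, hC, h⟩ := Grushin.exists_weak_type_of_continuous hn₁ V T hK hR₀ hsup hgrad
  exact Grushin.isWeakTypeOneOne_of_continuous T hC h
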